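/- Identify $\mathbb R^2$ with $\mathbb C$ and write $\Delta=\partial_x^2+\partial_y^2$ and $\frac{\partial}{\partial z}=\frac12\left(\frac{\partial}{\partial x}-i\frac{\partial}{\partial y}\right)$. A smooth Jordan domain is the interior region of a smooth Jordan curve (a smooth, regularly parametrized closed curve in $\mathbb C$ without self-intersections). For a domain $\Omega$ and a smooth real-valued function $\phi$ that is defined near $\partial\Omega$ and strictly subharmonic there (that is, $\Delta\phi>0$), a Schwarz function of $(\Omega,\phi)$ is a meromorphic function $S$ on $\Omega$ that extends continuously to $\partial\Omega$ and satisfies $S=\frac{\partial\phi}{\partial z}$ on $\partial\Omega$. Let $\Omega_0\subset\mathbb C$ be a smooth Jordan domain containing $0$, and let $\kappa$ be a smooth positive function defined on an open neighbourhood $V$ of $\partial\Omega_0$. Then there exist an open neighbourhood $U\subset V$ of $\partial\Omega_0$, a smooth positive function $\kappa'$ on $U$ with $\kappa'=\kappa$ on $U\setminus\Omega_0$, and a smooth strictly subharmonic function $\phi$ on $U$ with $\Delta\phi=1/\kappa'$ on $U$, such that $(\Omega_0,\phi)$ admits a Schwarz function $S_0$ that is holomorphic on $\Omega_0$ except for a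 simple pole at $0$. Moreover, if $\kappa$ is real analytic on $V$ and $\partial\Omega_0$ is real analytic (locally the graph of a real analytic function), then one can take $\kappa'=\kappa$ on $U$. -/

import Mathlib

open Set Filter Topology
open scoped ContDiff Laplacian

/-- The interior region of a smooth Jordan curve: `Ω` is a bounded domain whose boundary is the
trace of a smooth, regular, closed curve `γ` (of period `1`) without self-intersections. -/
def IsSmoothJordanDomain (Ω : Set ℂ) : Prop :=
  IsOpen Ω ∧ IsConnected Ω ∧ Bornology.IsBounded Ω ∧
    ∃ γ : ℝ → ℂ, ContDiff ℝ ∞ γ ∧ Function.Periodic γ 1 ∧ InjOn γ (Ico 0 1) ∧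
      (∀ t, deriv γ t ≠ 0) ∧ range γ = frontier Ω

/-- The boundary of `Ω` is locally the graph of a real analytic function: near each boundary
point `p` there are orthonormal coordinates `w = p + u * (x + i y)`, with `‖u‖ = 1`, in which the
boundary is `y = f x` for a function `f` that is real analytic near `0`. -/
def HasRealAnalyticBoundary (Ω : Set ℂ) : Prop :=
  ∀ p ∈ frontier Ω, ∃ u : ℂ, ‖u‖ = 1 ∧ ∃ f : ℝ → ℝ, AnalyticAt ℝ f 0 ∧
    ∀ᶠ w in 𝓝 p, (w ∈ frontier Ω ↔ ((w - p) / u).im = f ((w - p) / u).re)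

/-- The Wirtinger derivative `∂φ/∂z = (∂φ/∂x - i ∂φ/∂y) / 2` of a real-valued function. -/
noncomputable def wirtingerDz (φ : ℂ → ℝ) (z : ℂ) : ℂ :=
  ((fderiv ℝ φ z 1 : ℂ) - Complex.I * (fderiv ℝ φ z Complex.I : ℂ)) / 2

/-- `S` is a Schwarz function of the pair `(Ω, φ)`: it is meromorphic on `Ω`, extends continuously
to the boundary, and has the boundary values `∂φ/∂z`.  (The values of `S` on `frontier Ω` are those
of the extension.) -/
def IsSchwarzFunction (Ω : Set ℂ) (φ : ℂ → ℝ) (S : ℂ → ℂ) : Prop :=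
  MeromorphicOn S Ω ∧
    (∀ p ∈ frontier Ω, ContinuousWithinAt S (closure Ω) p) ∧
    ∀ p ∈ frontier Ω, S p = wirtingerDz φ p

/-- `S` is holomorphic on `Ω` except for a simple pole at `0`. -/
def HolomorphicExceptSimplePoleAtZero (Ω : Set ℂ) (S : ℂ → ℂ) : Prop :=
  DifferentiableOn ℂ S (Ω \ {0}) ∧ MeromorphicAt S 0 ∧ meromorphicOrderAt S 0 = -1

/-!
The function `log |z|²` is harmonic away from the origin and has Wirtinger derivative `1 / z`, so a
potential `φ = ψ - u + log |z|²` has a Schwarz function with a simple pole at `0` as soon as `ψ` has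
zero Cauchy data on the boundary of `Ω₀` and `u` is smooth on the plane and harmonic in `Ω₀`:
the Schwarz function is `1 / z - ∂u/∂z` (`isSchwarzFunction_inv_sub`). It remains to choose `ψ` and
`u` with `Δ (ψ - u) = 1 / κ` outside `Ω₀`, which amounts to a Cauchy problem for the Laplacian.

*Smooth data.* The boundary is the regular zero set of a smooth function `r`, negative in `Ω₀`, by
normal coordinates along the curve (`IsSmoothJordanDomain.exists_definingFunction`). A formal power
series in `r` solves the Cauchy problem `Δ ψ = 1 / κ` with zero data, and Borel summation
(`exists_contDiff_asymptotic_series`) turns it into a smooth `ψ` for which `Δ ψ - 1 / κ` is flat on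
the boundary (`exists_cauchy_solution_mod_flat`). By flatness this error stays smooth when it is
replaced by `0` in `Ω₀` (`contDiff_ite_mem_of_flat`). Its logarithmic potential `u`
(`exists_contDiff_laplacian_eq`) is then harmonic in `Ω₀` and corrects `ψ` exactly in the exterior.
In the interior the density is whatever `Δ ψ` is, which is positive near the boundary;
`κ' = 1 / Δ φ`.

*Real analytic data.* Here the Cauchy problem has an honest solution, and `u = 0`. Let `v` be any
smooth function with `Δ v = 1 / κ` near the boundary. In terms of the series of `1 / κ` in `z` and
its conjugate, `∂v/∂z` is a holomorphic function plus an explicit real analytic function, so on the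
boundary curve it agrees with a holomorphic function `k'`
(`exists_holomorphic_extension_wirtingerDz`), and `v - 2 Re k` is a solution near the given point,
up to an additive constant (`exists_isCauchySolution_ball`). The difference of two solutions is
harmonic and its derivative `∂/∂z` vanishes on the curve, hence everywhere
(`IsCauchySolution.eqOn`), and the local solutions glue.
-/

/-! ### Directional derivatives, the Laplacian and the Wirtinger derivative -/

theorem ContDiff.fderiv_apply_const {E F : Type*} [NormedAddCommGroup E] [NormedSpace ℝ E]
    [NormedAddCommGroup F] [NormedSpace ℝ F] {f : E → F} (hf : ContDiff ℝ ∞ f) (v : E) :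
    ContDiff ℝ ∞ (fun z => fderiv ℝ f z v) :=
  (hf.fderiv_right (m := ∞) (by simp)).clm_apply contDiff_const

theorem laplacian_eq_fderiv_fderiv {f : ℂ → ℝ} {z : ℂ} (hf : ContDiffAt ℝ 2 f z) :
    (Δ f) z = fderiv ℝ (fun w => fderiv ℝ f w 1) z 1
      + fderiv ℝ (fun w => fderiv ℝ f w Complex.I) z Complex.I := by
  have hd : DifferentiableAt ℝ (fderiv ℝ f) z :=
    (hf.fderiv_right (m := 1) (by norm_num)).differentiableAt (by norm_num)
  rw [InnerProductSpace.laplacian_eq_iteratedFDeriv_complexPlane]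
  simp only [iteratedFDeriv_two_apply]
  rw [fderiv_clm_apply hd (by fun_prop), fderiv_clm_apply hd (by fun_prop)]
  simp

theorem ContDiff.laplacian {f : ℂ → ℝ} (hf : ContDiff ℝ ∞ f) : ContDiff ℝ ∞ (Δ f) := by
  have : Δ f = fun z => fderiv ℝ (fun w => fderiv ℝ f w 1) z 1
      + fderiv ℝ (fun w => fderiv ℝ f w Complex.I) z Complex.I := by
    funext z
    exact laplacian_eq_fderiv_fderiv (hf.contDiffAt.of_le (by norm_cast))
  rw [this]
  exact ((hf.fderiv_apply_const 1).fderiv_apply_const 1).add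
    ((hf.fderiv_apply_const Complex.I).fderiv_apply_const Complex.I)

theorem wirtingerDz_congr {f g : ℂ → ℝ} {z : ℂ} (h : f =ᶠ[𝓝 z] g) :
    wirtingerDz f z = wirtingerDz g z := by
  simp [wirtingerDz, h.fderiv_eq]

theorem wirtingerDz_add {f g : ℂ → ℝ} {z : ℂ} (hf : DifferentiableAt ℝ f z)
    (hg : DifferentiableAt ℝ g z) :
    wirtingerDz (fun w => f w + g w) z = wirtingerDz f z + wirtingerDz g z := by
  simp only [wirtingerDz, fderiv_fun_add hf hg, add_apply]
  push_cast; ring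

theorem wirtingerDz_sub {f g : ℂ → ℝ} {z : ℂ} (hf : DifferentiableAt ℝ f z)
    (hg : DifferentiableAt ℝ g z) :
    wirtingerDz (fun w => f w - g w) z = wirtingerDz f z - wirtingerDz g z := by
  simp only [wirtingerDz, fderiv_fun_sub hf hg, sub_apply]
  push_cast; ring

theorem wirtingerDz_eq_zero_iff {f : ℂ → ℝ} {z : ℂ} : wirtingerDz f z = 0 ↔ fderiv ℝ f z = 0 := by
  constructor
  · intro h
    have h1 : ((fderiv ℝ f z 1 : ℂ) - Complex.I * (fderiv ℝ f z Complex.I : ℂ)) = 0 := by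
      simpa [wirtingerDz] using h
    have hre := congrArg Complex.re h1
    have him := congrArg Complex.im h1
    simp at hre him
    ext v
    have hv : v = v.re • (1 : ℂ) + v.im • Complex.I := by
      apply Complex.ext <;> simp
    rw [hv, map_add, map_smul, map_smul, hre, him]
    simp
  · intro h
    simp [wirtingerDz, h]

/-- The Wirtinger derivative of twice the real part of a holomorphic function is its complex
derivative. -/
theorem wirtingerDz_two_mul_re {k : ℂ → ℂ} {k' z : ℂ} (hk : HasDerivAt k k' z) :
    HasFDerivAt (fun w => 2 * (k w).re)
      ((2 : ℝ) • (Complex.reCLM.comp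
        ((ContinuousLinearMap.toSpanSingleton ℂ k').restrictScalars ℝ))) z ∧
    wirtingerDz (fun w => 2 * (k w).re) z = k' := by
  have h1 : HasFDerivAt (fun w => 2 * (k w).re)
      ((2 : ℝ) • (Complex.reCLM.comp
        ((ContinuousLinearMap.toSpanSingleton ℂ k').restrictScalars ℝ))) z := by
    have := (Complex.reCLM.hasFDerivAt.comp z (hk.hasFDerivAt.restrictScalars ℝ)).const_mul (2 : ℝ)
    exact this
  refine ⟨h1, ?_⟩
  rw [wirtingerDz, h1.fderiv]
  apply Complex.ext <;> simp

theorem wirtingerDz_differentiable {u : ℂ → ℝ} {z : ℂ} (hu : InnerProductSpace.HarmonicAt u z) :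
    DifferentiableAt ℂ (wirtingerDz u) z := by
  have := (HarmonicAt.differentiableAt_complex_partial hu).div_const 2
  exact this

theorem wirtingerDz_contDiff {u : ℂ → ℝ} (hu : ContDiff ℝ ∞ u) :
    ContDiff ℝ ∞ (wirtingerDz u) := by
  have h1 : ∀ v, ContDiff ℝ ∞ (fun z => (fderiv ℝ u z v : ℂ)) := fun v =>
    Complex.ofRealCLM.contDiff.comp (hu.fderiv_apply_const v)
  exact ((h1 1).sub (contDiff_const.mul (h1 Complex.I))).div_const 2

theorem harmonicAt_log_normSq {z : ℂ} (hz : z ≠ 0) :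
    InnerProductSpace.HarmonicAt (fun w : ℂ => 2 * Real.log ‖w‖) z := by
  have := (AnalyticAt.harmonicAt_log_norm (f := fun w : ℂ => w) analyticAt_id hz).const_smul
    (c := (2 : ℝ))
  exact this

theorem contDiffAt_log_norm {z : ℂ} (hz : z ≠ 0) :
    ContDiffAt ℝ ∞ (fun w : ℂ => 2 * Real.log ‖w‖) z :=
  contDiffAt_const.mul ((contDiffAt_norm ℝ hz).log (by simpa using hz))

theorem wirtingerDz_log_norm {z : ℂ} (hz : z ≠ 0) :
    wirtingerDz (fun w : ℂ => 2 * Real.log ‖w‖) z = 1 / z := by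
  have e : (fun w : ℂ => 2 * Real.log ‖w‖) = fun w => Real.log (Complex.normSq w) := by
    funext w
    rw [Complex.normSq_eq_norm_sq, Real.log_pow]; norm_num
  have hn : HasFDerivAt (fun w : ℂ => Complex.normSq w)
      ((2 * z.re) • Complex.reCLM + (2 * z.im) • Complex.imCLM) z := by
    have h1 := (Complex.reCLM.hasFDerivAt (x := z)).mul (Complex.reCLM.hasFDerivAt (x := z))
    have h2 := (Complex.imCLM.hasFDerivAt (x := z)).mul (Complex.imCLM.hasFDerivAt (x := z))
    convert! h1.add h2 using 1
    ext v
    simp; ring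
  have hz' : Complex.normSq z ≠ 0 := by simpa using hz
  have := hn.log hz'
  rw [wirtingerDz, e, this.fderiv, one_div, Complex.inv_def]
  apply Complex.ext <;> simp <;> field_simp

/-! ### Cutoff functions -/

theorem IsCompact.exists_smooth_cutoff {K W : Set ℂ} (hK : IsCompact K) (hW : IsOpen W)
    (hKW : K ⊆ W) : ∃ χ : ℂ → ℝ, ContDiff ℝ ∞ χ ∧ HasCompactSupport χ ∧ tsupport χ ⊆ W ∧
      ∀ᶠ z in 𝓝ˢ K, χ z = 1 := by
  obtain ⟨δ, hδ, hδW⟩ := hK.exists_cthickening_subset_open hW hKW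
  have hcl : IsClosed (Metric.thickening δ K)ᶜ := Metric.isOpen_thickening.isClosed_compl
  have hcl2 : IsClosed (Metric.cthickening (δ / 2) K) := Metric.isClosed_cthickening
  obtain ⟨χ, hχ, -, h0, h1⟩ := exists_contMDiff_zero_iff_one_iff_of_isClosed (n := (⊤ : ℕ∞))
    (modelWithCornersSelf ℝ ℂ) hcl hcl2 (by
      rw [disjoint_compl_left_iff_subset]
      exact Metric.cthickening_subset_thickening' hδ (by linarith) K)
  have hsupp : tsupport χ ⊆ Metric.cthickening δ K := by
    apply closure_minimal _ Metric.isClosed_cthickening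
    intro z hz
    by_contra hne
    apply hz
    apply (h0 z).1
    intro hz'
    exact hne (Metric.thickening_subset_cthickening δ K hz')
  refine ⟨χ, hχ.contDiff, ?_, hsupp.trans hδW, ?_⟩
  · exact hK.cthickening.of_isClosed_subset (isClosed_tsupport _) hsupp
  · have : Metric.thickening (δ / 2) K ∈ 𝓝ˢ K :=
      Metric.isOpen_thickening.mem_nhdsSet.2 (Metric.self_subset_thickening (by linarith) K)
    filter_upwards [this] with z hz
    exact (h1 z).1 (Metric.thickening_subset_cthickening _ _ hz)

/-- A function that is smooth near the support of a smooth cutoff becomes globally smooth after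
multiplication by the cutoff. -/
theorem ContDiff.mul_of_tsupport_subset {χ f : ℂ → ℝ} {W : Set ℂ} (hχ : ContDiff ℝ ∞ χ)
    (hW : IsOpen W) (hs : tsupport χ ⊆ W) (hf : ContDiffOn ℝ ∞ f W) :
    ContDiff ℝ ∞ (fun z => χ z * f z) := by
  rw [contDiff_iff_contDiffAt]
  intro z
  by_cases hz : z ∈ W
  · exact hχ.contDiffAt.mul (hf.contDiffAt (hW.mem_nhds hz))
  · have : (fun z => χ z * f z) =ᶠ[𝓝 z] fun _ => 0 := by
      have h1 : (tsupport χ)ᶜ ∈ 𝓝 z :=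
        (isClosed_tsupport χ).isOpen_compl.mem_nhds fun h => hz (hs h)
      filter_upwards [h1] with w hw
      rw [image_eq_zero_of_notMem_tsupport hw, zero_mul]
    exact contDiffAt_const.congr_of_eventuallyEq this

/-! ### The Poisson equation -/

open MeasureTheory in
theorem locallyIntegrable_norm_add_inv_norm :
    LocallyIntegrable (fun w : ℂ => ‖w‖ + ‖w‖⁻¹) := by
  refine continuous_norm.locallyIntegrable.add ?_
  refine locallyIntegrable_of_norm_le_rpow (C := 1) (α := 1) (by simp) (by simp) ?_ ?_
  · refine Eventually.of_forall fun w => ?_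
    rw [Real.rpow_neg (norm_nonneg _), Real.rpow_one]
    simp
  · exact (measurable_norm.inv).aestronglyMeasurable

theorem abs_log_le_add_inv {x : ℝ} (hx : 0 ≤ x) : |Real.log x| ≤ x + x⁻¹ := by
  rcases hx.eq_or_lt with rfl | hx
  · simp
  have h1 := Real.log_le_sub_one_of_pos hx
  have h2 := Real.log_le_sub_one_of_pos (inv_pos.2 hx)
  rw [Real.log_inv] at h2
  have := inv_pos.2 hx
  rw [abs_le]; constructor <;> linarith

open MeasureTheory in
theorem locallyIntegrable_log_norm : LocallyIntegrable (fun w : ℂ => Real.log ‖w‖) := by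
  refine locallyIntegrable_norm_add_inv_norm.mono ?_ ?_
  · exact (Real.measurable_log.comp measurable_norm).aestronglyMeasurable
  · refine Eventually.of_forall fun w => ?_
    have h0 : 0 ≤ ‖w‖ + ‖w‖⁻¹ := by positivity
    rw [Real.norm_eq_abs, Real.norm_of_nonneg h0]
    exact abs_log_le_add_inv (norm_nonneg _)

/-- The smooth function `log √(|w|² + ε²)`, a regularization of the logarithmic kernel. -/
noncomputable def regLog (ε : ℝ) (w : ℂ) : ℝ := Real.log (w.re * w.re + w.im * w.im + ε ^ 2) / 2

theorem regLog_arg_pos {ε : ℝ} (hε : 0 < ε) (w : ℂ) : 0 < w.re * w.re + w.im * w.im + ε ^ 2 := by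
  have := mul_self_nonneg w.re
  have := mul_self_nonneg w.im
  positivity

theorem hasFDerivAt_regLog_arg (ε : ℝ) (w : ℂ) :
    HasFDerivAt (fun w : ℂ => w.re * w.re + w.im * w.im + ε ^ 2)
      ((2 * w.re) • Complex.reCLM + (2 * w.im) • Complex.imCLM) w := by
  have h1 := (Complex.reCLM.hasFDerivAt (x := w)).mul (Complex.reCLM.hasFDerivAt (x := w))
  have h2 := (Complex.imCLM.hasFDerivAt (x := w)).mul (Complex.imCLM.hasFDerivAt (x := w))
  convert! (h1.add h2).add_const (ε ^ 2) using 1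
  ext v
  simp; ring

theorem contDiff_regLog {ε : ℝ} (hε : 0 < ε) : ContDiff ℝ ∞ (regLog ε) := by
  have h1 : ContDiff ℝ ∞ (fun w : ℂ => w.re * w.re + w.im * w.im + ε ^ 2) :=
    ((Complex.reCLM.contDiff.mul Complex.reCLM.contDiff).add
      (Complex.imCLM.contDiff.mul Complex.imCLM.contDiff)).add contDiff_const
  exact (h1.log fun w => (regLog_arg_pos hε w).ne').div_const 2

theorem fderiv_regLog {ε : ℝ} (hε : 0 < ε) (w v : ℂ) :
    fderiv ℝ (regLog ε) w v =
      (v.re * w.re + v.im * w.im) * (w.re * w.re + w.im * w.im + ε ^ 2)⁻¹ := by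
  have h := ((hasFDerivAt_regLog_arg ε w).log (regLog_arg_pos hε w).ne').mul_const (2⁻¹ : ℝ)
  have h' : HasFDerivAt (regLog ε) _ w := h
  rw [h'.fderiv]
  simp; ring

theorem laplacian_regLog {ε : ℝ} (hε : 0 < ε) (w : ℂ) :
    (Δ (regLog ε)) w = 2 * ε ^ 2 / (w.re * w.re + w.im * w.im + ε ^ 2) ^ 2 := by
  have key : ∀ v : ℂ, fderiv ℝ (fun w => fderiv ℝ (regLog ε) w v) w v =
      (v.re * v.re + v.im * v.im) * (w.re * w.re + w.im * w.im + ε ^ 2)⁻¹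
        - 2 * (v.re * w.re + v.im * w.im) ^ 2 / (w.re * w.re + w.im * w.im + ε ^ 2) ^ 2 := by
    intro v
    simp only [fderiv_regLog hε]
    have h1 := ((Complex.reCLM.hasFDerivAt (x := w)).const_mul v.re).add
      ((Complex.imCLM.hasFDerivAt (x := w)).const_mul v.im)
    have h2 := (hasDerivAt_inv (regLog_arg_pos hε w).ne').comp_hasFDerivAt w
      (hasFDerivAt_regLog_arg ε w)
    have h3 : HasFDerivAt (fun w : ℂ => (v.re * w.re + v.im * w.im) *
      (w.re * w.re + w.im * w.im + ε ^ 2)⁻¹) _ w := h1.mul h2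
    rw [h3.fderiv]
    have := (regLog_arg_pos hε w).ne'
    simp
    field_simp
    ring
  rw [laplacian_eq_fderiv_fderiv ((contDiff_regLog hε).contDiffAt.of_le (by norm_cast)), key, key]
  have := (regLog_arg_pos hε w).ne'
  simp
  field_simp
  ring

theorem HasCompactSupport.laplacian {f : ℂ → ℝ} (hf : HasCompactSupport f) :
    HasCompactSupport (Δ f) := by
  refine hf.mono' fun z hz => ?_
  by_contra hne
  apply hz
  have h1 : f =ᶠ[𝓝 z] fun _ => 0 := by
    filter_upwards [(isClosed_tsupport f).isOpen_compl.mem_nhds hne] with w hw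
    exact image_eq_zero_of_notMem_tsupport hw
  rw [InnerProductSpace.laplacian_congr_nhds h1 |>.eq_of_nhds]
  simp

open MeasureTheory in
/-- Green's second identity. There are no boundary terms, since `f` has compact support. -/
theorem integral_mul_laplacian {g f : ℂ → ℝ} (hg : ContDiff ℝ ∞ g) (hf : ContDiff ℝ ∞ f)
    (hfc : HasCompactSupport f) : ∫ w, g w * (Δ f) w = ∫ w, (Δ g) w * f w := by
  have hint : ∀ {a b : ℂ → ℝ}, ContDiff ℝ ∞ a → ContDiff ℝ ∞ b → HasCompactSupport b →
      Integrable (fun w => a w * b w) := fun ha hb hbc =>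
    (ha.continuous.mul hb.continuous).integrable_of_hasCompactSupport hbc.mul_left
  have key : ∀ v, ∫ w, g w * fderiv ℝ (fun w => fderiv ℝ f w v) w v =
      ∫ w, fderiv ℝ (fun w => fderiv ℝ g w v) w v * f w := by
    intro v
    have hf1 := hf.fderiv_apply_const v
    have hg1 := hg.fderiv_apply_const v
    have hf1c := hfc.fderiv_apply (𝕜 := ℝ) v
    rw [integral_mul_fderiv_eq_neg_fderiv_mul_of_integrable (hint hg1 hf1 hf1c)
      (hint hg (hf1.fderiv_apply_const v) (hf1c.fderiv_apply (𝕜 := ℝ) v)) (hint hg hf1 hf1c)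
      (fun x _ => hg.differentiable (by simp) x) (fun x _ => hf1.differentiable (by simp) x),
      integral_mul_fderiv_eq_neg_fderiv_mul_of_integrable
      (hint (hg1.fderiv_apply_const v) hf hfc) (hint hg1 hf1 hf1c) (hint hg1 hf hfc)
      (fun x _ => hg1.differentiable (by simp) x) (fun x _ => hf.differentiable (by simp) x),
      neg_neg]
  have hI : ∀ v, Integrable (fun w => g w * fderiv ℝ (fun w => fderiv ℝ f w v) w v) := fun v =>
    hint hg ((hf.fderiv_apply_const v).fderiv_apply_const v)
      ((hfc.fderiv_apply (𝕜 := ℝ) v).fderiv_apply (𝕜 := ℝ) v)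
  have hJ : ∀ v, Integrable (fun w => fderiv ℝ (fun w => fderiv ℝ g w v) w v * f w) := fun v =>
    hint ((hg.fderiv_apply_const v).fderiv_apply_const v) hf hfc
  have e1 : ∀ w, (Δ f) w = _ := fun w =>
    laplacian_eq_fderiv_fderiv (hf.contDiffAt.of_le (by norm_cast))
  have e2 : ∀ w, (Δ g) w = _ := fun w =>
    laplacian_eq_fderiv_fderiv (hg.contDiffAt.of_le (by norm_cast))
  simp only [e1, e2, mul_add, add_mul]
  rw [integral_add (hI _) (hI _), integral_add (hJ _) (hJ _), key, key]

/-- The profile `2 / (1 + |w|²)²`, which is the Laplacian of `regLog 1`. -/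
noncomputable def bubble (w : ℂ) : ℝ := 2 / (w.re * w.re + w.im * w.im + 1) ^ 2

theorem bubble_pos (w : ℂ) : 0 < bubble w := by
  have := regLog_arg_pos one_pos w
  rw [bubble]; rw [one_pow] at this; positivity

theorem continuous_bubble : Continuous bubble := by
  unfold bubble
  refine continuous_const.div (by fun_prop) fun w => ?_
  have := regLog_arg_pos one_pos w
  rw [one_pow] at this; positivity

open MeasureTheory in
theorem integrable_bubble : Integrable bubble := by
  have h := (integrable_rpow_neg_one_add_norm_sq (E := ℂ) (μ := volume) (r := 4)
    (by simp; norm_num)).const_mul 2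
  refine h.congr (Eventually.of_forall fun w => ?_)
  have : (1 : ℝ) + ‖w‖ ^ 2 = w.re * w.re + w.im * w.im + 1 := by
    rw [← Complex.normSq_eq_norm_sq, Complex.normSq_apply]; ring
  have h2 : (-4 / 2 : ℝ) = -((2 : ℕ) : ℝ) := by norm_num
  simp only [bubble]
  rw [this, h2, Real.rpow_neg (by have := regLog_arg_pos one_pos w; rw [one_pow] at this; positivity),
    Real.rpow_natCast, div_eq_mul_inv]

open MeasureTheory in
theorem integral_bubble_pos : 0 < ∫ w, bubble w := by
  refine integral_pos_of_integrable_nonneg_nonzero continuous_bubble integrable_bubble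
    (fun w => (bubble_pos w).le) (x := 0) (bubble_pos 0).ne'

open MeasureTheory in
/-- The Laplacian of `regLog ε` is the rescaled profile `ε⁻² * bubble (w / ε)`. -/
theorem integral_laplacian_regLog_mul {ε : ℝ} (hε : 0 < ε) (f : ℂ → ℝ) :
    ∫ w, (Δ (regLog ε)) w * f w = ∫ v, bubble v * f (ε • v) := by
  have h := Measure.integral_comp_smul (volume : Measure ℂ)
    (fun w => (Δ (regLog ε)) w * f w) ε
  have e : ∀ v : ℂ, (Δ (regLog ε)) (ε • v) * f (ε • v) = (ε ^ 2)⁻¹ * (bubble v * f (ε • v)) := by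
    intro v
    rw [laplacian_regLog hε, bubble, ← mul_assoc]
    congr 1
    have h1 := regLog_arg_pos one_pos v
    rw [one_pow] at h1
    simp only [Complex.real_smul, Complex.mul_re, Complex.mul_im, Complex.ofReal_re,
      Complex.ofReal_im, zero_mul, sub_zero, add_zero]
    have h2 : ε * v.re * (ε * v.re) + ε * v.im * (ε * v.im) + ε ^ 2 =
      ε ^ 2 * (v.re * v.re + v.im * v.im + 1) := by ring
    rw [h2]
    field_simp
  simp only [e] at h
  rw [integral_const_mul, Complex.finrank_real_complex, smul_eq_mul,
    abs_of_pos (by positivity)] at h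
  exact (mul_left_cancel₀ (by positivity) h).symm

theorem re_mul_re_add_im_mul_im (w : ℂ) : w.re * w.re + w.im * w.im = ‖w‖ ^ 2 := by
  rw [← Complex.normSq_eq_norm_sq, Complex.normSq_apply]

theorem abs_regLog_le {ε : ℝ} (hε : 0 < ε) (hε1 : ε ≤ 1) {w : ℂ} (hw : w ≠ 0) :
    |regLog ε w| ≤ ‖w‖ + ‖w‖⁻¹ + (‖w‖ ^ 2 + 1) := by
  have hpos : 0 < ‖w‖ := norm_pos_iff.2 hw
  have hargp := regLog_arg_pos hε w
  have hε2 : ε ^ 2 ≤ 1 := pow_le_one₀ hε.le hε1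
  have hsq := sq_nonneg ‖w‖
  rw [re_mul_re_add_im_mul_im] at hargp
  have up : regLog ε w ≤ ‖w‖ ^ 2 + 1 := by
    rw [regLog, re_mul_re_add_im_mul_im]
    have h1 := Real.log_le_sub_one_of_pos hargp
    linarith
  have low : Real.log ‖w‖ ≤ regLog ε w := by
    rw [regLog, re_mul_re_add_im_mul_im, le_div_iff₀ two_pos, mul_comm]
    have : (2 : ℝ) * Real.log ‖w‖ = Real.log (‖w‖ ^ 2) := by rw [Real.log_pow]; norm_num
    rw [this]
    exact Real.log_le_log (by positivity) (by have := sq_nonneg ε; linarith)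
  have hl := abs_le.1 (abs_log_le_add_inv hpos.le)
  have h3 : 0 ≤ ‖w‖ + ‖w‖⁻¹ := by positivity
  rw [abs_le]
  exact ⟨by linarith [hl.1], by linarith⟩

theorem tendsto_regLog {ε : ℕ → ℝ} (hε : Tendsto ε atTop (𝓝 0)) {w : ℂ} (hw : w ≠ 0) :
    Tendsto (fun n => regLog (ε n) w) atTop (𝓝 (Real.log ‖w‖)) := by
  have h1 : Tendsto (fun n => w.re * w.re + w.im * w.im + ε n ^ 2) atTop (𝓝 (‖w‖ ^ 2)) := by
    have := (tendsto_const_nhds (x := ‖w‖ ^ 2)).add (hε.pow 2)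
    rw [re_mul_re_add_im_mul_im]
    simpa using this
  have h2 := (h1.log (by have := norm_pos_iff.2 hw; positivity)).div_const 2
  rw [Real.log_pow] at h2
  have h3 : ((2 : ℕ) : ℝ) * Real.log ‖w‖ / 2 = Real.log ‖w‖ := by push_cast; ring
  rw [h3] at h2
  exact h2

open MeasureTheory in
theorem tendsto_integral_regLog_mul {ε : ℕ → ℝ} (hε : ∀ n, 0 < ε n) (hε1 : ∀ n, ε n ≤ 1)
    (hεlim : Tendsto ε atTop (𝓝 0)) {g : ℂ → ℝ} (hg : Continuous g) (hgc : HasCompactSupport g) :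
    Tendsto (fun n => ∫ w, regLog (ε n) w * g w) atTop (𝓝 (∫ w, Real.log ‖w‖ * g w)) := by
  have hne : ∀ᵐ w : ℂ, w ≠ 0 := by simp [ae_iff]
  refine tendsto_integral_of_dominated_convergence
    (fun w => (‖w‖ + ‖w‖⁻¹ + (‖w‖ ^ 2 + 1)) * |g w|) ?_ ?_ ?_ ?_
  · intro n
    exact ((contDiff_regLog (hε n)).continuous.mul hg).aestronglyMeasurable
  · have hc : Continuous fun w : ℂ => ‖w‖ ^ 2 + 1 := by fun_prop
    exact (locallyIntegrable_norm_add_inv_norm.add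
      hc.locallyIntegrable).integrable_smul_right_of_hasCompactSupport
      (g := fun w => |g w|) hg.abs (hgc.comp_left abs_zero)
  · intro n
    filter_upwards [hne] with w hw
    rw [norm_mul, Real.norm_eq_abs, Real.norm_eq_abs]
    exact mul_le_mul_of_nonneg_right (abs_regLog_le (hε n) (hε1 n) hw) (abs_nonneg _)
  · filter_upwards [hne] with w hw
    exact (tendsto_regLog hεlim hw).mul_const _

open MeasureTheory in
theorem tendsto_integral_bubble_mul {ε : ℕ → ℝ} (hεlim : Tendsto ε atTop (𝓝 0)) {f : ℂ → ℝ}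
    (hf : Continuous f) (hfc : HasCompactSupport f) :
    Tendsto (fun n => ∫ v, bubble v * f (ε n • v)) atTop (𝓝 (∫ v, bubble v * f 0)) := by
  obtain ⟨C, hC⟩ := hfc.exists_bound_of_continuous hf
  refine tendsto_integral_of_dominated_convergence (fun v => bubble v * C) ?_ ?_ ?_ ?_
  · intro n
    exact (continuous_bubble.mul (hf.comp (continuous_const_smul _))).aestronglyMeasurable
  · exact integrable_bubble.mul_const C
  · intro n
    refine Eventually.of_forall fun v => ?_
    rw [norm_mul, Real.norm_of_nonneg (bubble_pos v).le]
    exact mul_le_mul_of_nonneg_left (hC _) (bubble_pos v).le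
  · refine Eventually.of_forall fun v => ?_
    refine Tendsto.const_mul _ ?_
    have h0 : Tendsto (fun n => ε n • v) atTop (𝓝 0) := by
      have := hεlim.smul_const v
      rwa [zero_smul] at this
    exact (hf.tendsto 0).comp h0

open MeasureTheory in
/-- Up to a positive constant, `log |w|` is a fundamental solution of the Laplacian. The
regularized kernels `regLog ε` have the approximate identity `ε⁻² * bubble (w / ε)` as
Laplacian. -/
theorem integral_log_norm_mul_laplacian {f : ℂ → ℝ} (hf : ContDiff ℝ ∞ f)
    (hfc : HasCompactSupport f) :
    ∫ w, Real.log ‖w‖ * (Δ f) w = (∫ w, bubble w) * f 0 := by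
  set ε : ℕ → ℝ := fun n => 1 / ((n : ℝ) + 1) with hεdef
  have hε : ∀ n, 0 < ε n := fun n => by positivity
  have hε1 : ∀ n, ε n ≤ 1 := fun n => by
    rw [hεdef]; simp only
    rw [div_le_one (by positivity)]
    have : (0 : ℝ) ≤ n := by positivity
    linarith
  have hεlim : Tendsto ε atTop (𝓝 0) := tendsto_one_div_add_atTop_nhds_zero_nat
  have lim1 := tendsto_integral_regLog_mul hε hε1 hεlim hf.laplacian.continuous hfc.laplacian
  have heq : ∀ n, ∫ w, regLog (ε n) w * (Δ f) w = ∫ v, bubble v * f (ε n • v) := fun n => by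
    rw [integral_mul_laplacian (contDiff_regLog (hε n)) hf hfc,
      integral_laplacian_regLog_mul (hε n)]
  simp only [heq] at lim1
  rw [tendsto_nhds_unique lim1 (tendsto_integral_bubble_mul hεlim hf.continuous hfc),
    integral_mul_const]

open MeasureTheory in
/-- Every smooth compactly supported function on the plane is the Laplacian of a smooth function,
namely of its logarithmic potential. -/
theorem exists_contDiff_laplacian_eq {F : ℂ → ℝ} (hF : ContDiff ℝ ∞ F)
    (hFc : HasCompactSupport F) : ∃ u : ℂ → ℝ, ContDiff ℝ ∞ u ∧ ∀ z, (Δ u) z = F z := by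
  let ℓ : ℂ → ℝ := fun w => Real.log ‖w‖
  have hℓ : LocallyIntegrable ℓ := locallyIntegrable_log_norm
  let P : (ℂ → ℝ) → ℂ → ℝ := fun g => convolution ℓ g (ContinuousLinearMap.lsmul ℝ ℝ) volume
  have hPs : ∀ g : ℂ → ℝ, ContDiff ℝ ∞ g → HasCompactSupport g → ContDiff ℝ ∞ (P g) :=
    fun g hg hgc =>
    hgc.contDiff_convolution_right (n := (⊤ : ℕ∞)) _ hℓ hg
  have hPd : ∀ g : ℂ → ℝ, ContDiff ℝ ∞ g → HasCompactSupport g → ∀ v,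
      (fun z => fderiv ℝ (P g) z v) = P (fun z => fderiv ℝ g z v) := by
    intro g hg hgc v
    funext z
    rw [(hgc.hasFDerivAt_convolution_right _ hℓ (hg.of_le (by norm_cast)) z).fderiv,
      convolution_precompR_apply _ hℓ (hgc.fderiv ℝ) (hg.continuous_fderiv (by simp))]
  have hconv : ∀ g : ℂ → ℝ, ContDiff ℝ ∞ g → HasCompactSupport g → ∀ v w z : ℂ,
      fderiv ℝ (fun w => fderiv ℝ (fun w => g (z - w)) w v) w v =
      fderiv ℝ (fun w => fderiv ℝ g w v) (z - w) v := by
    intro g hg hgc v w z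
    have h1 : ∀ {a : ℂ → ℝ}, Differentiable ℝ a → ∀ w, fderiv ℝ (fun w => a (z - w)) w v =
        - fderiv ℝ a (z - w) v := by
      intro a ha w
      have := (ha (z - w)).hasFDerivAt.comp w ((hasFDerivAt_id w).const_sub z)
      have h2 : HasFDerivAt (fun w => a (z - w)) _ w := this
      rw [h2.fderiv]; simp
    simp only [h1 (hg.differentiable (by simp))]
    rw [fderiv_fun_neg, neg_apply, h1 ((hg.fderiv_apply_const v).differentiable (by simp)), neg_neg]
  have hΔ : ∀ z, (Δ (P F)) z = (∫ w, bubble w) * F z := by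
    intro z
    have hF1 := fun v => hF.fderiv_apply_const v
    have hF1c := fun v => hFc.fderiv_apply (𝕜 := ℝ) v
    rw [laplacian_eq_fderiv_fderiv ((hPs F hF hFc).contDiffAt.of_le (by norm_cast)),
      hPd F hF hFc, hPd F hF hFc]
    rw [congrFun (hPd _ (hF1 1) (hF1c 1) 1) z,
      congrFun (hPd _ (hF1 Complex.I) (hF1c Complex.I) Complex.I) z]
    have hfs : ContDiff ℝ ∞ (fun w => F (z - w)) := hF.comp (contDiff_const.sub contDiff_id)
    have hfc : HasCompactSupport (fun w => F (z - w)) :=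
      hFc.comp_homeomorph (Homeomorph.subLeft z)
    have hmain := integral_log_norm_mul_laplacian hfs hfc
    rw [sub_zero] at hmain
    rw [← hmain]
    have e1 : ∀ w, (Δ fun w => F (z - w)) w = _ := fun w =>
      laplacian_eq_fderiv_fderiv (hfs.contDiffAt.of_le (by norm_cast))
    simp only [e1, hconv F hF hFc, mul_add]
    have hI : ∀ v, Integrable (fun w : ℂ => Real.log ‖w‖ *
        fderiv ℝ (fun w => fderiv ℝ F w v) (z - w) v) := fun v =>
      hℓ.integrable_smul_right_of_hasCompactSupport
        (((hF1 v).fderiv_apply_const v).continuous.comp (continuous_const.sub continuous_id))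
        (((hF1c v).fderiv_apply (𝕜 := ℝ) v).comp_homeomorph (Homeomorph.subLeft z))
    rw [integral_add (hI _) (hI _)]
    rfl
  have hc := integral_bubble_pos
  refine ⟨(∫ w, bubble w)⁻¹ • P F, ?_, fun z => ?_⟩
  · exact ContDiff.const_smul (∫ w, bubble w)⁻¹ (hPs F hF hFc)
  rw [InnerProductSpace.laplacian_smul (∫ w, bubble w)⁻¹
    ((hPs F hF hFc).contDiffAt.of_le (by norm_cast)), hΔ, smul_eq_mul, inv_mul_cancel_left₀ hc.ne']

/-! ### A defining function of a smooth Jordan domain -/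

/-- The inverse function theorem, packaged with a smooth local inverse. -/
theorem exists_contDiffAt_local_inverse {f : ℂ → ℂ} (hf : ContDiff ℝ ∞ f) {a : ℂ}
    (ha : fderiv ℝ f a ∈ range ((↑) : (ℂ ≃L[ℝ] ℂ) → ℂ →L[ℝ] ℂ)) :
    ∃ g : ℂ → ℂ, ContDiffAt ℝ ∞ g (f a) ∧ g (f a) = a ∧
      (∀ᶠ z in 𝓝 (f a), f (g z) = z) ∧ ∀ᶠ ζ in 𝓝 a, g (f ζ) = ζ := by
  obtain ⟨e, he⟩ := ha
  have h1 : HasFDerivAt f (e : ℂ →L[ℝ] ℂ) a := by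
    rw [he]; exact (hf.differentiable (by simp) a).hasFDerivAt
  have hn : (∞ : WithTop ℕ∞) ≠ 0 := by simp
  have hs := hf.contDiffAt.hasStrictFDerivAt' h1 hn
  exact ⟨hf.contDiffAt.localInverse h1 hn, hf.contDiffAt.to_localInverse h1 hn,
    hf.contDiffAt.localInverse_apply_image h1 hn, hs.eventually_right_inverse,
    hs.eventually_left_inverse⟩

/-- Normal coordinates along the curve `γ`: the point at signed distance `im ζ * ‖γ'‖` from
`γ (re ζ)` along the normal. -/
noncomputable def normalTube (γ : ℝ → ℂ) (ζ : ℂ) : ℂ :=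
  γ ζ.re + ζ.im • (Complex.I * deriv γ ζ.re)

section NormalTube

variable {γ : ℝ → ℂ}

theorem contDiff_normalTube (hγ : ContDiff ℝ ∞ γ) : ContDiff ℝ ∞ (normalTube γ) := by
  have h1 : ContDiff ℝ ∞ (deriv γ) := (contDiff_infty_iff_deriv.1 hγ).2
  have hre : ContDiff ℝ ∞ Complex.re := Complex.reCLM.contDiff
  have him : ContDiff ℝ ∞ Complex.im := Complex.imCLM.contDiff
  exact (hγ.comp hre).add (him.smul (contDiff_const.mul (h1.comp hre)))

theorem normalTube_ofReal (γ : ℝ → ℂ) (t : ℝ) : normalTube γ t = γ t := by simp [normalTube]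

theorem normalTube_of_im_eq_zero {γ : ℝ → ℂ} {ζ : ℂ} (h : ζ.im = 0) :
    normalTube γ ζ = γ ζ.re := by simp [normalTube, h]

theorem normalTube_add_int (hper : Function.Periodic γ 1) (ζ : ℂ) (m : ℤ) :
    normalTube γ (ζ + m) = normalTube γ ζ := by
  have h1 : ∀ x : ℝ, γ (x + m) = γ x := fun x => by
    simpa using hper.int_mul m x
  have h2 : deriv γ (ζ.re + m) = deriv γ ζ.re := by
    rw [← deriv_comp_add_const]
    simp only [h1]
  simp [normalTube, h1, h2]

theorem fderiv_normalTube_mem_range (hγ : ContDiff ℝ ∞ γ) {t : ℝ} (ht : deriv γ t ≠ 0) :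
    fderiv ℝ (normalTube γ) t ∈ range ((↑) : (ℂ ≃L[ℝ] ℂ) → ℂ →L[ℝ] ℂ) := by
  let e : ℂ ≃L[ℂ] ℂ := ContinuousLinearEquiv.unitsEquivAut ℂ (Units.mk0 _ ht)
  refine ⟨e.restrictScalars ℝ, ?_⟩
  have hd : ContDiff ℝ ∞ (deriv γ) := (contDiff_infty_iff_deriv.1 hγ).2
  have h1 : HasFDerivAt (fun ζ : ℂ => γ ζ.re) _ (t : ℂ) :=
    HasFDerivAt.comp (g := γ) (t : ℂ) (hγ.differentiable (by simp) _).hasFDerivAt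
      Complex.reCLM.hasFDerivAt
  have h2 : HasFDerivAt (fun ζ : ℂ => deriv γ ζ.re) _ (t : ℂ) :=
    HasFDerivAt.comp (g := deriv γ) (t : ℂ) (hd.differentiable (by simp) _).hasFDerivAt
      Complex.reCLM.hasFDerivAt
  have h3 : HasFDerivAt (normalTube γ) _ (t : ℂ) :=
    h1.add ((Complex.imCLM.hasFDerivAt (x := (t : ℂ))).smul (h2.const_mul Complex.I))
  rw [h3.fderiv]
  ext v
  suffices v * deriv γ t = v.re * deriv γ t + v.im * (Complex.I * deriv γ t) by
    simpa [e, ContinuousLinearEquiv.unitsEquivAut_apply] using this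
  conv_lhs => rw [← Complex.re_add_im v]
  ring

theorem exists_int_add_eq (hper : Function.Periodic γ 1) (hinj : InjOn γ (Ico 0 1)) {s t : ℝ}
    (h : γ s = γ t) : ∃ m : ℤ, t + m = s := by
  have hf : ∀ x : ℝ, γ (Int.fract x) = γ x := fun x => by
    have := hper.sub_int_mul_eq (x := x) ⌊x⌋
    rw [← this, Int.fract, mul_one]
  have h1 : Int.fract s = Int.fract t := by
    refine hinj ⟨Int.fract_nonneg s, Int.fract_lt_one s⟩ ⟨Int.fract_nonneg t, Int.fract_lt_one t⟩ ?_
    rw [hf, hf, h]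
  refine ⟨⌊s⌋ - ⌊t⌋, ?_⟩
  have e1 := Int.floor_add_fract s
  have e2 := Int.floor_add_fract t
  push_cast
  linarith

/-- The signed distance is well defined in a thin tube around a closed curve without
self-intersections: otherwise, by compactness, pairs of points with the same image and different
signed distances accumulate at the same point of the curve, where normal coordinates are locally
injective. -/
theorem exists_normalTube_im_injective (hγ : ContDiff ℝ ∞ γ) (hper : Function.Periodic γ 1)
    (hinj : InjOn γ (Ico 0 1)) (hd : ∀ t, deriv γ t ≠ 0) :
    ∃ ε > 0, ∀ ζ ζ' : ℂ, |ζ.im| < ε → |ζ'.im| < ε → normalTube γ ζ = normalTube γ ζ' →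
      ζ.im = ζ'.im := by
  by_contra! hcon
  have hpos : ∀ n : ℕ, (0 : ℝ) < 1 / ((n : ℝ) + 1) := fun n => by positivity
  choose a b ha hb hab hne using fun n : ℕ => hcon (1 / ((n : ℝ) + 1)) (hpos n)
  -- By periodicity both sequences may be moved to a compact rectangle.
  let a' : ℕ → ℂ := fun n => a n + ((-⌊(a n).re⌋ : ℤ) : ℂ)
  let b' : ℕ → ℂ := fun n => b n + ((-⌊(b n).re⌋ : ℤ) : ℂ)
  have ha'im : ∀ n, (a' n).im = (a n).im := fun n => by simp [a']
  have hb'im : ∀ n, (b' n).im = (b n).im := fun n => by simp [b']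
  have hle : ∀ n : ℕ, 1 / ((n : ℝ) + 1) ≤ 1 := fun n => by
    rw [div_le_one (by positivity)]
    have : (0 : ℝ) ≤ n := by positivity
    linarith
  let K : Set ℂ := Icc (0 : ℝ) 1 ×ℂ Icc (-1 : ℝ) 1
  have hK : IsCompact K := isCompact_Icc.reProdIm isCompact_Icc
  have hmem : ∀ (c : ℂ) (n : ℕ), |c.im| < 1 / ((n : ℝ) + 1) →
      c + ((-⌊c.re⌋ : ℤ) : ℂ) ∈ K := by
    intro c n hc
    have h1 := Int.floor_add_fract c.re
    have h2 := Int.fract_nonneg c.re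
    have h3 := (Int.fract_lt_one c.re).le
    have h4 := abs_le.1 (hc.le.trans (hle n))
    rw [Complex.mem_reProdIm]
    simp only [Complex.add_re, Complex.add_im, Complex.intCast_re, Complex.intCast_im, add_zero]
    push_cast
    exact ⟨⟨by linarith, by linarith⟩, h4⟩
  have hpair : ∀ n, ((a' n, b' n) : ℂ × ℂ) ∈ K ×ˢ K := fun n =>
    ⟨hmem (a n) n (ha n), hmem (b n) n (hb n)⟩
  obtain ⟨⟨A, B⟩, -, φ, hφ, hlim⟩ := (hK.prod hK).tendsto_subseq hpair
  have hA : Tendsto (fun n => a' (φ n)) atTop (𝓝 A) := (continuous_fst.tendsto _).comp hlim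
  have hB : Tendsto (fun n => b' (φ n)) atTop (𝓝 B) := (continuous_snd.tendsto _).comp hlim
  have hzero : Tendsto (fun n => 1 / (((φ n : ℕ) : ℝ) + 1)) atTop (𝓝 0) :=
    (tendsto_one_div_add_atTop_nhds_zero_nat (𝕜 := ℝ)).comp hφ.tendsto_atTop
  have him : ∀ {c : ℕ → ℂ} {C : ℂ}, Tendsto (fun n => c (φ n)) atTop (𝓝 C) →
      (∀ n, |(c n).im| < 1 / ((n : ℝ) + 1)) → C.im = 0 := by
    intro c C hC hc
    have h1 : Tendsto (fun n => (c (φ n)).im) atTop (𝓝 0) :=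
      squeeze_zero_norm (fun n => (hc (φ n)).le) hzero
    exact tendsto_nhds_unique ((Complex.continuous_im.tendsto C).comp hC) h1
  have hA0 : A.im = 0 := him hA fun n => by rw [ha'im]; exact ha n
  have hB0 : B.im = 0 := him hB fun n => by rw [hb'im]; exact hb n
  have hcont := (contDiff_normalTube hγ).continuous
  have heq : ∀ n, normalTube γ (a' n) = normalTube γ (b' n) := fun n => by
    simp only [a', b', normalTube_add_int hper, hab]
  have hAB : γ A.re = γ B.re := by
    have h1 := (hcont.tendsto A).comp hA
    have h2 := (hcont.tendsto B).comp hB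
    have h3 : (normalTube γ ∘ fun n => a' (φ n)) = normalTube γ ∘ fun n => b' (φ n) := by
      funext n; exact heq _
    rw [h3] at h1
    have := tendsto_nhds_unique h1 h2
    rwa [normalTube_of_im_eq_zero hA0, normalTube_of_im_eq_zero hB0] at this
  obtain ⟨m, hm⟩ := exists_int_add_eq hper hinj hAB
  have hBA : B + m = A := by
    apply Complex.ext <;> simp [hm, hA0, hB0]
  have hB2 : Tendsto (fun n => b' (φ n) + m) atTop (𝓝 A) := by
    rw [← hBA]; exact hB.add_const _
  have hAre : ((A.re : ℝ) : ℂ) = A := by apply Complex.ext <;> simp [hA0]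
  obtain ⟨g, -, -, -, hg⟩ := exists_contDiffAt_local_inverse (contDiff_normalTube hγ)
    (fderiv_normalTube_mem_range hγ (hd A.re))
  rw [hAre] at hg
  obtain ⟨n, hn1, hn2⟩ := ((hA.eventually hg).and (hB2.eventually hg)).exists
  apply hne (φ n)
  have : a' (φ n) = b' (φ n) + m := by
    rw [← hn1, ← hn2, normalTube_add_int hper (b' (φ n)) m, heq]
  rw [← ha'im, ← hb'im, this]
  simp

end NormalTube

/-- Near its boundary, a smooth Jordan domain is a sublevel set `{r < 0}` of a smooth function
without critical points. The function is, up to sign, the normal coordinate along the boundary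
curve; as both sides of the tube around the curve are connected, each of them lies in the domain or
in its exterior. They cannot both lie in the domain because then its closure would be open, nor
both in the exterior because boundary points are limits of points of the domain. -/
theorem IsSmoothJordanDomain.exists_definingFunction {Ω : Set ℂ} (h : IsSmoothJordanDomain Ω) :
    ∃ (W : Set ℂ) (r : ℂ → ℝ), IsOpen W ∧ frontier Ω ⊆ W ∧ ContDiffOn ℝ ∞ r W ∧
      (∀ z ∈ W, fderiv ℝ r z ≠ 0) ∧ (∀ z ∈ W, z ∈ frontier Ω ↔ r z = 0) ∧
      ∀ z ∈ W, z ∈ Ω ↔ r z < 0 := by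
  obtain ⟨hopen, hconn, hbdd, γ, hγ, hper, hinj, hd, hrange⟩ := h
  obtain ⟨ε, hε, htube⟩ := exists_normalTube_im_injective hγ hper hinj hd
  have hΦ := contDiff_normalTube hγ
  let N : Set ℂ := {ζ | |ζ.im| < ε} ∩
    (fderiv ℝ (normalTube γ)) ⁻¹' range ((↑) : (ℂ ≃L[ℝ] ℂ) → ℂ →L[ℝ] ℂ)
  have hN : IsOpen N := (isOpen_lt (by fun_prop) continuous_const).inter
    (ContinuousLinearEquiv.isOpen.preimage (hΦ.continuous_fderiv (by simp)))
  let W : Set ℂ := normalTube γ '' N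
  classical
  let r : ℂ → ℝ := fun z =>
    if h : ∃ ζ : ℂ, |ζ.im| < ε ∧ normalTube γ ζ = z then h.choose.im else 0
  have hr : ∀ ζ : ℂ, |ζ.im| < ε → r (normalTube γ ζ) = ζ.im := by
    intro ζ hζ
    have hex : ∃ ζ' : ℂ, |ζ'.im| < ε ∧ normalTube γ ζ' = normalTube γ ζ := ⟨ζ, hζ, rfl⟩
    simp only [r, dif_pos hex]
    exact htube _ _ hex.choose_spec.1 hζ hex.choose_spec.2
  have hWopen : IsOpen W := by
    rw [isOpen_iff_mem_nhds]
    rintro _ ⟨ζ, hζ, rfl⟩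
    obtain ⟨g, hg, hga, hg1, -⟩ := exists_contDiffAt_local_inverse hΦ hζ.2
    have hgN : ∀ᶠ z in 𝓝 (normalTube γ ζ), g z ∈ N :=
      hg.continuousAt.eventually_mem (by rw [hga]; exact hN.mem_nhds hζ)
    filter_upwards [hg1, hgN] with z h1 h2
    exact ⟨g z, h2, h1⟩
  have hfW : frontier Ω ⊆ W := by
    rw [← hrange]
    rintro _ ⟨t, rfl⟩
    refine ⟨t, ⟨by simpa using hε, fderiv_normalTube_mem_range hγ (hd t)⟩, normalTube_ofReal γ t⟩
  have hrs : ContDiffOn ℝ ∞ r W := by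
    rintro _ ⟨ζ, hζ, rfl⟩
    apply ContDiffAt.contDiffWithinAt
    obtain ⟨g, hg, hga, hg1, -⟩ := exists_contDiffAt_local_inverse hΦ hζ.2
    have hgN : ∀ᶠ z in 𝓝 (normalTube γ ζ), g z ∈ N :=
      hg.continuousAt.eventually_mem (by rw [hga]; exact hN.mem_nhds hζ)
    have heq : r =ᶠ[𝓝 (normalTube γ ζ)] fun z => (g z).im := by
      filter_upwards [hg1, hgN] with z h1 h2
      rw [← hr _ h2.1, h1]
    exact (Complex.imCLM.contDiff.contDiffAt.comp _ hg).congr_of_eventuallyEq heq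
  have hrd : ∀ z ∈ W, fderiv ℝ r z ≠ 0 := by
    rintro _ ⟨ζ, hζ, rfl⟩ h0
    have h1 : DifferentiableAt ℝ r (normalTube γ ζ) :=
      (hrs.contDiffAt (hWopen.mem_nhds ⟨ζ, hζ, rfl⟩)).differentiableAt (by simp)
    have h2 := h1.hasFDerivAt.comp ζ (hΦ.differentiable (by simp) ζ).hasFDerivAt
    have heq : (r ∘ normalTube γ) =ᶠ[𝓝 ζ] Complex.imCLM := by
      filter_upwards [hN.mem_nhds hζ] with w hw
      exact hr w hw.1
    have h3 := (h2.congr_of_eventuallyEq heq.symm).unique Complex.imCLM.hasFDerivAt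
    rw [h0] at h3
    have := congrArg (fun L : ℂ →L[ℝ] ℝ => L Complex.I) h3
    simp at this
  have hr0 : ∀ ζ : ℂ, |ζ.im| < ε → (normalTube γ ζ ∈ frontier Ω ↔ ζ.im = 0) := by
    intro ζ hζ
    rw [← hrange]
    constructor
    · rintro ⟨t, ht⟩
      rw [← hr ζ hζ, ← ht, ← normalTube_ofReal γ t, hr _ (by simpa using hε)]
      simp
    · intro h0
      exact ⟨ζ.re, (normalTube_of_im_eq_zero h0).symm⟩
  have hside : ∀ S : Set ℂ, Convex ℝ S → (∀ ζ ∈ S, |ζ.im| < ε ∧ ζ.im ≠ 0) →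
      normalTube γ '' S ⊆ Ω ∨ normalTube γ '' S ⊆ (closure Ω)ᶜ := by
    intro S hS hSim
    refine IsPreconnected.subset_or_subset hopen isClosed_closure.isOpen_compl
      (disjoint_compl_right.mono_left subset_closure) ?_
      (hS.isPreconnected.image _ hΦ.continuous.continuousOn)
    rintro _ ⟨ζ, hζ, rfl⟩
    by_contra hne
    rw [mem_union, not_or, mem_compl_iff, not_not] at hne
    have : normalTube γ ζ ∈ frontier Ω := by
      rw [hopen.frontier_eq]; exact ⟨hne.2, hne.1⟩
    exact (hSim ζ hζ).2 ((hr0 ζ (hSim ζ hζ).1).1 this)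
  have hlin : IsLinearMap ℝ Complex.im := ⟨Complex.add_im, fun c x => by simp⟩
  have hP := hside {ζ | ζ.im ∈ Ioo 0 ε} ((convex_Ioo 0 ε).is_linear_preimage hlin)
    fun ζ hζ => ⟨abs_lt.2 ⟨by linarith [hζ.1], hζ.2⟩, hζ.1.ne'⟩
  have hM := hside {ζ | ζ.im ∈ Ioo (-ε) 0} ((convex_Ioo (-ε) 0).is_linear_preimage hlin)
    fun ζ hζ => ⟨abs_lt.2 ⟨hζ.1, by linarith [hζ.2]⟩, hζ.2.ne⟩
  have hdisj : ∀ z ∈ frontier Ω, z ∉ Ω := fun z hz hz' => by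
    rw [hopen.frontier_eq] at hz; exact hz.2 hz'
  have hposmem : ∀ ζ : ℂ, |ζ.im| < ε → 0 < ζ.im →
      normalTube γ ζ ∈ normalTube γ '' {ζ | ζ.im ∈ Ioo 0 ε} := fun ζ h1 h2 =>
    ⟨ζ, ⟨h2, (abs_lt.1 h1).2⟩, rfl⟩
  have hnegmem : ∀ ζ : ℂ, |ζ.im| < ε → ζ.im < 0 →
      normalTube γ ζ ∈ normalTube γ '' {ζ | ζ.im ∈ Ioo (-ε) 0} := fun ζ h1 h2 =>
    ⟨ζ, ⟨(abs_lt.1 h1).1, h2⟩, rfl⟩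
  have hext : ∀ z ∈ (closure Ω)ᶜ, z ∉ Ω := fun z hz hz' => hz (subset_closure hz')
  rcases hP with hP | hP <;> rcases hM with hM | hM
  · exfalso
    have hcl : closure Ω = Ω ∪ W := by
      apply Subset.antisymm
      · intro z hz
        by_cases hzΩ : z ∈ Ω
        · exact Or.inl hzΩ
        · exact Or.inr (hfW (by rw [hopen.frontier_eq]; exact ⟨hz, hzΩ⟩))
      · rintro z (hz | ⟨ζ, hζ, rfl⟩)
        · exact subset_closure hz
        · rcases lt_trichotomy ζ.im 0 with h0 | h0 | h0
          · exact subset_closure (hM (hnegmem ζ hζ.1 h0))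
          · exact frontier_subset_closure ((hr0 ζ hζ.1).2 h0)
          · exact subset_closure (hP (hposmem ζ hζ.1 h0))
    have hclopen : IsClopen (closure Ω) := ⟨isClosed_closure, by rw [hcl]; exact hopen.union hWopen⟩
    have huniv := hclopen.eq_univ hconn.nonempty.closure
    have := hbdd.closure
    rw [huniv] at this
    exact NormedSpace.unbounded_univ ℝ ℂ this
  · refine ⟨W, fun z => - r z, hWopen, hfW, hrs.neg, ?_, ?_, ?_⟩
    · intro z hz
      rw [fderiv_fun_neg]
      exact neg_ne_zero.2 (hrd z hz)
    · rintro _ ⟨ζ, hζ, rfl⟩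
      simp only
      rw [hr0 ζ hζ.1, hr ζ hζ.1, neg_eq_zero]
    · rintro _ ⟨ζ, hζ, rfl⟩
      simp only
      rw [hr ζ hζ.1, neg_lt_zero]
      constructor
      · intro hz
        by_contra hle
        rcases (not_lt.1 hle).lt_or_eq with h0 | h0
        · exact hext _ (hM (hnegmem ζ hζ.1 h0)) hz
        · exact hdisj _ ((hr0 ζ hζ.1).2 h0) hz
      · exact fun h0 => hP (hposmem ζ hζ.1 h0)
  · refine ⟨W, r, hWopen, hfW, hrs, hrd, ?_, ?_⟩
    · rintro _ ⟨ζ, hζ, rfl⟩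
      rw [hr0 ζ hζ.1, hr ζ hζ.1]
    · rintro _ ⟨ζ, hζ, rfl⟩
      rw [hr ζ hζ.1]
      constructor
      · intro hz
        by_contra hle
        rcases (not_lt.1 hle).lt_or_eq with h0 | h0
        · exact hext _ (hP (hposmem ζ hζ.1 h0)) hz
        · exact hdisj _ ((hr0 ζ hζ.1).2 h0.symm) hz
      · exact fun h0 => hM (hnegmem ζ hζ.1 h0)
  · exfalso
    have hp : γ 0 ∈ frontier Ω := hrange ▸ mem_range_self 0
    obtain ⟨z, ⟨ζ, hζ, rfl⟩, hzΩ⟩ := mem_closure_iff.1 (frontier_subset_closure hp) W hWopen (hfW hp)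
    rcases lt_trichotomy ζ.im 0 with h0 | h0 | h0
    · exact hext _ (hM (hnegmem ζ hζ.1 h0)) hzΩ
    · exact hdisj _ ((hr0 ζ hζ.1).2 h0) hzΩ
    · exact hext _ (hP (hposmem ζ hζ.1 h0)) hzΩ

/-! ### Borel summation along a hypersurface -/

theorem natCast_le_infty (n : ℕ) : ((n : ℕ) : WithTop ℕ∞) ≤ ∞ := by exact_mod_cast le_top

theorem exists_bound_iteratedFDeriv {E : Type*} [NormedAddCommGroup E] [NormedSpace ℝ E]
    {f : E → ℝ} (hf : ContDiff ℝ ∞ f) (hfc : HasCompactSupport f) (m : ℕ) :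
    ∃ C, 0 ≤ C ∧ ∀ i ≤ m, ∀ z, ‖iteratedFDeriv ℝ i f z‖ ≤ C := by
  have h : ∀ i : ℕ, ∃ C, ∀ z, ‖iteratedFDeriv ℝ i f z‖ ≤ C := fun i =>
    (hfc.iteratedFDeriv (𝕜 := ℝ) i).exists_bound_of_continuous
      (hf.continuous_iteratedFDeriv (natCast_le_infty _))
  choose C hC using h
  refine ⟨∑ i ∈ Finset.range (m + 1), |C i|, Finset.sum_nonneg fun i _ => abs_nonneg _,
    fun i hi z => ?_⟩
  calc ‖iteratedFDeriv ℝ i f z‖ ≤ |C i| := (hC i z).trans (le_abs_self _)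
    _ ≤ _ := Finset.single_le_sum (f := fun i => |C i|) (fun i _ => abs_nonneg _)
      (Finset.mem_range.2 (by omega))

/-- Rescaling the argument of `g` by `l` costs a factor `l ^ m` in the `m`-th derivative. -/
theorem exists_bound_iteratedFDeriv_mul_comp {b r : ℂ → ℝ} {g : ℝ → ℝ} (hb : ContDiff ℝ ∞ b)
    (hbc : HasCompactSupport b) (hr : ContDiff ℝ ∞ r) (hrc : HasCompactSupport r)
    (hg : ContDiff ℝ ∞ g) (hgc : HasCompactSupport g) (m : ℕ) :
    ∃ C, ∀ l : ℝ, 1 ≤ l → ∀ z,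
      ‖iteratedFDeriv ℝ m (fun z => b z * g (l * r z)) z‖ ≤ C * l ^ m := by
  obtain ⟨B, hB0, hB⟩ := exists_bound_iteratedFDeriv hb hbc m
  obtain ⟨R, hR0, hR⟩ := exists_bound_iteratedFDeriv hr hrc m
  obtain ⟨G, hG0, hG⟩ := exists_bound_iteratedFDeriv hg hgc m
  refine ⟨∑ i ∈ Finset.range (m + 1),
    (m.choose i : ℝ) * B * ((m - i).factorial * G * (R + 1) ^ (m - i)), fun l hl z => ?_⟩
  have hlr : ContDiff ℝ ∞ (fun z => l * r z) := contDiff_const.mul hr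
  have hcomp : ContDiff ℝ ∞ (fun z => g (l * r z)) := hg.comp hlr
  have hm : ((m : ℕ) : WithTop ℕ∞) ≤ ∞ := natCast_le_infty m
  refine (norm_iteratedFDeriv_mul_le hb hcomp z hm).trans ?_
  rw [Finset.sum_mul]
  refine Finset.sum_le_sum fun i hi => ?_
  have hi' : i ≤ m := by have := Finset.mem_range.1 hi; omega
  have h1 : ‖iteratedFDeriv ℝ (m - i) (fun z => g (l * r z)) z‖ ≤
      (m - i).factorial * G * (l * (R + 1)) ^ (m - i) := by
    refine norm_iteratedFDeriv_comp_le hg hlr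
      (natCast_le_infty _) z ?_ ?_
    · exact fun j hj => hG j (by omega) _
    · intro j hj1 hj
      have e : (fun z => l * r z) = fun z => l • r z := rfl
      rw [e, iteratedFDeriv_const_smul_apply' (hr.contDiffAt.of_le (natCast_le_infty _)),
        norm_smul, Real.norm_of_nonneg (by linarith)]
      calc l * ‖iteratedFDeriv ℝ j r z‖ ≤ l * (R + 1) :=
            mul_le_mul_of_nonneg_left ((hR j (by omega) z).trans (by linarith)) (by linarith)
        _ ≤ (l * (R + 1)) ^ j := le_self_pow₀ (by nlinarith) (by omega)
  have h2 : l ^ (m - i) ≤ l ^ m := pow_le_pow_right₀ hl (by omega)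
  calc (m.choose i : ℝ) * ‖iteratedFDeriv ℝ i b z‖ *
        ‖iteratedFDeriv ℝ (m - i) (fun z => g (l * r z)) z‖
      ≤ (m.choose i : ℝ) * B * ((m - i).factorial * G * (l * (R + 1)) ^ (m - i)) := by
        gcongr
        exact hB i hi' z
    _ = (m.choose i : ℝ) * B * ((m - i).factorial * G * (R + 1) ^ (m - i)) * l ^ (m - i) := by
        rw [mul_pow]; ring
    _ ≤ _ := by gcongr

/-- A term `b * r ^ i * θ (l * r)` of a Borel series has derivatives of order less than `i` that are
as small as desired when the cutoff `θ (l * r)` is concentrated enough on `{r = 0}`. -/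
theorem eventually_iteratedFDeriv_cutoff_le {b r : ℂ → ℝ} {θ : ℝ → ℝ} (hb : ContDiff ℝ ∞ b)
    (hbc : HasCompactSupport b) (hr : ContDiff ℝ ∞ r) (hrc : HasCompactSupport r)
    (hθ : ContDiff ℝ ∞ θ) (hθc : HasCompactSupport θ) {m i : ℕ} (hmi : m < i) {η : ℝ}
    (hη : 0 < η) :
    ∀ᶠ l : ℝ in atTop, ∀ z,
      ‖iteratedFDeriv ℝ m (fun z => b z * (r z ^ i * θ (l * r z))) z‖ ≤ η := by
  obtain ⟨C, hC⟩ := exists_bound_iteratedFDeriv_mul_comp (g := fun x => x ^ i * θ x) hb hbc hr hrc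
    ((contDiff_id.pow i).mul hθ) hθc.mul_left m
  have hC0 : 0 ≤ C := by
    have := (norm_nonneg _).trans (hC 1 le_rfl 0)
    simpa using this
  filter_upwards [eventually_ge_atTop (1 : ℝ), eventually_ge_atTop (C / η)] with l hl1 hl z
  have hl0 : 0 < l := by linarith
  have e : (fun z => b z * (r z ^ i * θ (l * r z))) =
      fun z => (l ^ i)⁻¹ • (b z * ((l * r z) ^ i * θ (l * r z))) := by
    funext z
    rw [smul_eq_mul, mul_pow]
    field_simp
  have hs : ContDiff ℝ ∞ (fun z => b z * ((l * r z) ^ i * θ (l * r z))) :=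
    hb.mul (((contDiff_const.mul hr).pow i).mul (hθ.comp (contDiff_const.mul hr)))
  rw [e, iteratedFDeriv_const_smul_apply' (hs.contDiffAt.of_le (natCast_le_infty _)),
    norm_smul, Real.norm_of_nonneg (by positivity)]
  calc (l ^ i)⁻¹ * _ ≤ (l ^ i)⁻¹ * (C * l ^ m) :=
        mul_le_mul_of_nonneg_left (hC l hl1 z) (by positivity)
    _ ≤ (l ^ (m + 1))⁻¹ * (C * l ^ m) := by
        gcongr
        exact hmi
    _ = C / l := by rw [pow_succ]; field_simp
    _ ≤ η := by rw [div_le_iff₀ hl0]; rwa [div_le_iff₀ hη, mul_comm] at hl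

/-- Borel's lemma along the zero set of `r`: every formal power series in `r` with smooth
coefficients is the asymptotic expansion of a smooth function. -/
theorem exists_contDiff_asymptotic_series {r : ℂ → ℝ} (hr : ContDiff ℝ ∞ r)
    (hrc : HasCompactSupport r) {b : ℕ → ℂ → ℝ} (hb : ∀ k, ContDiff ℝ ∞ (b k))
    (hbc : ∀ k, HasCompactSupport (b k)) :
    ∃ ψ : ℂ → ℝ, ContDiff ℝ ∞ ψ ∧ ∀ N : ℕ, ∃ τ : ℂ → ℝ, ContDiff ℝ ∞ τ ∧ ∃ δ > 0, ∀ z, |r z| < δ →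
      ψ z = ∑ k ∈ Finset.range N, b k z * r z ^ k + r z ^ N * τ z := by
  let θ : ContDiffBump (0 : ℝ) := ⟨1, 2, one_pos, one_lt_two⟩
  have hθ : ContDiff ℝ ∞ θ := θ.contDiff
  have hex : ∀ k : ℕ, ∃ l : ℝ, 0 < l ∧ ∀ i ∈ Finset.range (k + 1), ∀ m ∈ Finset.range i, ∀ z,
      ‖iteratedFDeriv ℝ m (fun z => b k z * (r z ^ i * θ (l * r z))) z‖ ≤ (1 / 2) ^ k := by
    intro k
    refine ((eventually_gt_atTop (0 : ℝ)).and ?_).exists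
    rw [Filter.eventually_all_finset]
    intro i _
    rw [Filter.eventually_all_finset]
    intro m hm
    exact eventually_iteratedFDeriv_cutoff_le (hb k) (hbc k) hr hrc hθ θ.hasCompactSupport
      (Finset.mem_range.1 hm) (by positivity)
  choose l hl0 hl using hex
  let T : ℕ → ℕ → ℂ → ℝ := fun k i z => b k z * (r z ^ i * θ (l k * r z))
  have hT : ∀ k i, ContDiff ℝ ∞ (T k i) := fun k i =>
    (hb k).mul ((hr.pow i).mul (hθ.comp (contDiff_const.mul hr)))
  have hgeo : Summable fun k : ℕ => (1 / 2 : ℝ) ^ k := summable_geometric_two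
  have hτ : ∀ N, ContDiff ℝ ∞ (fun z => ∑' k, T (k + N) k z) := by
    intro N
    refine contDiff_tsum_of_eventually (N := (⊤ : ℕ∞)) (v := fun _ k => (1 / 2 : ℝ) ^ k)
      (fun k => hT _ _) (fun _ _ => hgeo) fun m _ => ?_
    rw [Nat.cofinite_eq_atTop]
    filter_upwards [eventually_gt_atTop m] with k hk z
    refine (hl (k + N) k (Finset.mem_range.2 (by omega)) m (Finset.mem_range.2 hk) z).trans ?_
    exact pow_le_pow_of_le_one (by norm_num) (by norm_num) (by omega)
  refine ⟨fun z => ∑' k, T k k z, hτ 0, fun N => ⟨_, hτ N, ?_⟩⟩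
  have hsum : ∀ z, Summable fun k => T k k z := by
    intro z
    refine Summable.of_norm_bounded_eventually_nat hgeo ?_
    filter_upwards [eventually_gt_atTop 0] with k hk
    have := hl k k (Finset.mem_range.2 (by omega)) 0 (Finset.mem_range.2 hk) z
    rwa [norm_iteratedFDeriv_zero] at this
  have hLpos : 0 < ∑ k ∈ Finset.range N, l k + 1 :=
    add_pos_of_nonneg_of_pos (Finset.sum_nonneg fun k _ => (hl0 k).le) one_pos
  refine ⟨1 / (∑ k ∈ Finset.range N, l k + 1), by positivity, fun z hz => ?_⟩
  beta_reduce
  rw [← (hsum z).sum_add_tsum_nat_add N, ← tsum_mul_left]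
  congr 1
  · refine Finset.sum_congr rfl fun k hk => ?_
    have h1 : l k ≤ ∑ k ∈ Finset.range N, l k + 1 :=
      (Finset.single_le_sum (f := l) (fun k _ => (hl0 k).le) hk).trans (by linarith)
    have h2 : θ (l k * r z) = 1 := by
      apply θ.one_of_mem_closedBall
      rw [mem_closedBall_zero_iff, Real.norm_eq_abs, abs_mul, abs_of_pos (hl0 k)]
      rw [lt_div_iff₀ hLpos] at hz
      calc l k * |r z| ≤ (∑ k ∈ Finset.range N, l k + 1) * |r z| := by gcongr
        _ ≤ 1 := by rw [mul_comm]; exact hz.le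
    simp only [T, h2, mul_one]
  · refine tsum_congr fun k => ?_
    simp only [T]
    ring

/-! ### Solving the Cauchy problem to infinite order -/

theorem fderiv_fderiv_mul_pow {b r : ℂ → ℝ} (hb : ContDiff ℝ ∞ b) (hr : ContDiff ℝ ∞ r) (k : ℕ)
    (v z : ℂ) :
    fderiv ℝ (fun w => fderiv ℝ (fun z => b z * r z ^ (k + 2)) w v) z v =
      r z ^ k * ((k + 2) * (k + 1) * b z * fderiv ℝ r z v ^ 2 +
        r z * ((k + 2) * (2 * fderiv ℝ b z v * fderiv ℝ r z v
            + b z * fderiv ℝ (fun w => fderiv ℝ r w v) z v)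
          + r z * fderiv ℝ (fun w => fderiv ℝ b w v) z v)) := by
  have h1 : ∀ (n : ℕ) {a : ℂ → ℝ}, ContDiff ℝ ∞ a → ∀ w,
      fderiv ℝ (fun z => a z * r z ^ (n + 1)) w v =
        a w * ((n + 1) * r w ^ n * fderiv ℝ r w v) + r w ^ (n + 1) * fderiv ℝ a w v := by
    intro n a ha w
    have hp := ((hr.differentiable (by simp) w).hasFDerivAt.pow (n + 1))
    have hm : HasFDerivAt (fun z => a z * r z ^ (n + 1)) _ w :=
      (ha.differentiable (by simp) w).hasFDerivAt.mul hp
    rw [hm.fderiv]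
    simp
  have e : (fun w => fderiv ℝ (fun z => b z * r z ^ (k + 2)) w v) = fun w =>
      ((k + 2) * (b w * fderiv ℝ r w v)) * r w ^ (k + 1)
        + fderiv ℝ b w v * r w ^ ((k + 1) + 1) := by
    funext w
    rw [h1 (k + 1) hb w]
    push_cast
    ring
  have hbv := hb.fderiv_apply_const v
  have hrv := hr.fderiv_apply_const v
  have hbr : ContDiff ℝ ∞ (fun w => ((k : ℝ) + 2) * (b w * fderiv ℝ r w v)) :=
    contDiff_const.mul (hb.mul hrv)
  have hd : fderiv ℝ (fun w => ((k : ℝ) + 2) * (b w * fderiv ℝ r w v)) z v =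
      (k + 2) * (b z * fderiv ℝ (fun w => fderiv ℝ r w v) z v + fderiv ℝ r z v * fderiv ℝ b z v) := by
    have hm : HasFDerivAt (fun w => ((k : ℝ) + 2) * (b w * fderiv ℝ r w v)) _ z :=
      ((hb.differentiable (by simp) z).hasFDerivAt.mul
        (hrv.differentiable (by simp) z).hasFDerivAt).const_mul _
    rw [hm.fderiv]
    simp
    ring
  rw [e, fderiv_fun_add
    ((hbr.mul (hr.pow (k + 1))).differentiable (by simp) z)
    ((hbv.mul (hr.pow (k + 1 + 1))).differentiable (by simp) z), add_apply, h1 k hbr z,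
    h1 (k + 1) hbv z, hd]
  push_cast
  ring

/-- The squared norm of the gradient of `r`. -/
noncomputable def gradSq (r : ℂ → ℝ) (z : ℂ) : ℝ :=
  fderiv ℝ r z 1 ^ 2 + fderiv ℝ r z Complex.I ^ 2

theorem gradSq_pos {r : ℂ → ℝ} {z : ℂ} (h : fderiv ℝ r z ≠ 0) : 0 < gradSq r z := by
  by_contra hle
  apply h
  have h1 := sq_nonneg (fderiv ℝ r z 1)
  have h2 := sq_nonneg (fderiv ℝ r z Complex.I)
  rw [gradSq] at hle
  rw [← wirtingerDz_eq_zero_iff, wirtingerDz, pow_eq_zero_iff two_ne_zero |>.1 (by linarith :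
    fderiv ℝ r z 1 ^ 2 = 0), pow_eq_zero_iff two_ne_zero |>.1 (by linarith :
    fderiv ℝ r z Complex.I ^ 2 = 0)]
  simp

/-- The leading term of `Δ (b * r ^ (k + 2))` comes from differentiating the power of `r` twice. -/
theorem exists_laplacian_mul_pow {b r : ℂ → ℝ} (hb : ContDiff ℝ ∞ b) (hr : ContDiff ℝ ∞ r)
    (k : ℕ) : ∃ s : ℂ → ℝ, ContDiff ℝ ∞ s ∧ ∀ z, (Δ fun z => b z * r z ^ (k + 2)) z =
      r z ^ k * ((k + 2) * (k + 1) * b z * gradSq r z + r z * s z) := by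
  let s : ℂ → ℂ → ℝ := fun v z => (k + 2) * (2 * fderiv ℝ b z v * fderiv ℝ r z v
            + b z * fderiv ℝ (fun w => fderiv ℝ r w v) z v)
          + r z * fderiv ℝ (fun w => fderiv ℝ b w v) z v
  have hs : ∀ v, ContDiff ℝ ∞ (s v) := fun v =>
    (contDiff_const.mul (((contDiff_const.mul (hb.fderiv_apply_const v)).mul
      (hr.fderiv_apply_const v)).add
      (hb.mul ((hr.fderiv_apply_const v).fderiv_apply_const v)))).add
      (hr.mul ((hb.fderiv_apply_const v).fderiv_apply_const v))
  refine ⟨fun z => s 1 z + s Complex.I z, (hs 1).add (hs Complex.I), fun z => ?_⟩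
  have h2 : ContDiff ℝ ∞ (fun z => b z * r z ^ (k + 2)) := hb.mul (hr.pow _)
  rw [laplacian_eq_fderiv_fderiv (h2.contDiffAt.of_le (by norm_cast)),
    fderiv_fderiv_mul_pow hb hr, fderiv_fderiv_mul_pow hb hr, gradSq]
  simp only [s]
  ring

/-- The Cauchy problem `Δ ψ = ρ` with zero data on the noncharacteristic curve `{r = 0}` has a
solution up to an error that vanishes to infinite order on the curve. The coefficients of the
formal solution `∑ c_k r ^ (k + 2)` are found recursively, since `Δ (c r ^ (k + 2))` equals
`(k + 2) (k + 1) c |∇ r| ^ 2 r ^ k` up to a multiple of `r ^ (k + 1)`; the formal solution is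
then summed by Borel's lemma. -/
theorem exists_cauchy_solution_mod_flat {r ρ q : ℂ → ℝ} {W : Set ℂ} (hr : ContDiff ℝ ∞ r)
    (hrc : HasCompactSupport r) (hρ : ContDiff ℝ ∞ ρ) (hq : ContDiff ℝ ∞ q)
    (hqc : HasCompactSupport q) (hqW : ∀ z ∈ W, q z * gradSq r z = 1) :
    ∃ ψ : ℂ → ℝ, ContDiff ℝ ∞ ψ ∧ (∀ z, r z = 0 → fderiv ℝ ψ z = 0) ∧
      ∀ N : ℕ, ∃ s : ℂ → ℝ, ContDiff ℝ ∞ s ∧ ∃ δ > 0, ∀ z ∈ W, |r z| < δ →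
        (Δ ψ) z - ρ z = r z ^ N * s z := by
  have hstep : ∀ (k : ℕ) (e : {e : ℂ → ℝ // ContDiff ℝ ∞ e}), ∃ e' : {e : ℂ → ℝ // ContDiff ℝ ∞ e},
      ∀ z ∈ W, (Δ fun z => (((k : ℝ) + 2) * (k + 1))⁻¹ * (e.1 z * q z) * r z ^ (k + 2)) z =
        r z ^ k * (e.1 z - r z * e'.1 z) := by
    rintro k ⟨e, he⟩
    obtain ⟨s, hs, hΔ⟩ := exists_laplacian_mul_pow
      (b := fun z => (((k : ℝ) + 2) * (k + 1))⁻¹ * (e z * q z))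
      (contDiff_const.mul (he.mul hq)) hr k
    refine ⟨⟨fun z => - s z, hs.neg⟩, fun z hz => ?_⟩
    rw [hΔ]
    have h1 : ((k : ℝ) + 2) * (k + 1) * ((((k : ℝ) + 2) * (k + 1))⁻¹ * (e z * q z)) * gradSq r z =
        e z := by
      have : ((k : ℝ) + 2) * (k + 1) ≠ 0 := by positivity
      rw [mul_inv_cancel_left₀ this, mul_assoc, hqW z hz, mul_one]
    rw [h1]
    simp only
    ring
  choose next hnext using hstep
  let e : ℕ → {e : ℂ → ℝ // ContDiff ℝ ∞ e} := fun n => Nat.rec ⟨ρ, hρ⟩ next n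
  let c : ℕ → ℂ → ℝ := fun k z => (((k : ℝ) + 2) * (k + 1))⁻¹ * ((e k).1 z * q z)
  have hc : ∀ k, ContDiff ℝ ∞ (c k) := fun k => contDiff_const.mul ((e k).2.mul hq)
  have hcc : ∀ k, HasCompactSupport (c k) := fun k => (hqc.mul_left).mul_left
  have hcr : ∀ k, ContDiff ℝ ∞ (fun z => c k z * r z ^ (k + 2)) := fun k => (hc k).mul (hr.pow _)
  have hpart : ∀ N, ContDiff ℝ ∞ (fun z => ∑ k ∈ Finset.range N, c k z * r z ^ (k + 2)) := fun N =>
    ContDiff.sum fun k _ => hcr k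
  have hΔadd : ∀ {f g : ℂ → ℝ}, ContDiff ℝ ∞ f → ContDiff ℝ ∞ g → ∀ z,
      (Δ fun z => f z + g z) z = (Δ f) z + (Δ g) z := fun hf hg z =>
    ContDiffAt.laplacian_add (hf.contDiffAt.of_le (by norm_cast))
      (hg.contDiffAt.of_le (by norm_cast))
  have hformal : ∀ N, ∀ z ∈ W,
      (Δ fun z => ∑ k ∈ Finset.range N, c k z * r z ^ (k + 2)) z = ρ z - r z ^ N * (e N).1 z := by
    intro N
    induction N with
    | zero =>
      intro z _
      simp [e]
    | succ N ih =>
      intro z hz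
      simp only [Finset.sum_range_succ]
      rw [hΔadd (hpart N) (hcr N), ih z hz]
      have h1 : (Δ fun z => c N z * r z ^ (N + 2)) z = _ := hnext N (e N) z hz
      have h2 : next N (e N) = e (N + 1) := rfl
      rw [h1, h2]
      ring
  obtain ⟨Ψ, hΨ, hΨexp⟩ := exists_contDiff_asymptotic_series hr hrc hc hcc
  refine ⟨fun z => Ψ z * r z ^ 2, hΨ.mul (hr.pow 2), fun z hz => ?_, fun N => ?_⟩
  · have hm : HasFDerivAt (fun z => Ψ z * r z ^ 2) _ z :=
      (hΨ.differentiable (by simp) z).hasFDerivAt.mul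
        ((hr.differentiable (by simp) z).hasFDerivAt.pow 2)
    rw [hm.fderiv, hz]
    simp
  · obtain ⟨τ, hτ, δ, hδ, hexp⟩ := hΨexp N
    obtain ⟨s, hs, hΔs⟩ := exists_laplacian_mul_pow hτ hr N
    have hG : ContDiff ℝ ∞ (gradSq r) :=
      ((hr.fderiv_apply_const 1).pow 2).add ((hr.fderiv_apply_const Complex.I).pow 2)
    refine ⟨fun z => (N + 2) * (N + 1) * τ z * gradSq r z + r z * s z - (e N).1 z,
      (((contDiff_const.mul hτ).mul hG).add (hr.mul hs)).sub (e N).2, δ, hδ, fun z hz hzδ => ?_⟩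
    have heq : (fun z => Ψ z * r z ^ 2) =ᶠ[𝓝 z] fun z =>
        (∑ k ∈ Finset.range N, c k z * r z ^ (k + 2)) + τ z * r z ^ (N + 2) := by
      have : {w | |r w| < δ} ∈ 𝓝 z :=
        (isOpen_lt hr.continuous.abs continuous_const).mem_nhds hzδ
      filter_upwards [this] with w hw
      rw [hexp w hw, add_mul, Finset.sum_mul]
      congr 1
      · exact Finset.sum_congr rfl fun k _ => by ring
      · ring
    rw [(InnerProductSpace.laplacian_congr_nhds heq).eq_of_nhds,
      hΔadd (hpart N) (hτ.mul (hr.pow _)), hformal N z hz, hΔs]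
    ring

/-! ### Cutting off functions that are flat on the boundary -/

/-- The truncated power `x₊ ^ n`. -/
noncomputable def truncPow (n : ℕ) (x : ℝ) : ℝ := if x < 0 then 0 else x ^ n

theorem truncPow_succ (n : ℕ) (x : ℝ) : truncPow (n + 1) x = truncPow n x * x := by
  unfold truncPow; split_ifs <;> ring

theorem continuous_truncPow_succ (n : ℕ) : Continuous (truncPow (n + 1)) := by
  have : truncPow (n + 1) = fun x => (max x 0) ^ (n + 1) := by
    funext x
    unfold truncPow
    split_ifs with h
    · rw [max_eq_right h.le]; simp
    · rw [max_eq_left (not_lt.1 h)]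
  rw [this]
  fun_prop

theorem hasDerivAt_truncPow (n : ℕ) (x : ℝ) :
    HasDerivAt (truncPow (n + 2)) ((n + 2) * truncPow (n + 1) x) x := by
  rcases lt_trichotomy x 0 with hx | rfl | hx
  · have h1 : truncPow (n + 2) =ᶠ[𝓝 x] fun _ => 0 := by
      filter_upwards [gt_mem_nhds hx] with y hy
      simp [truncPow, hy]
    have h2 : truncPow (n + 1) x = 0 := by simp [truncPow, hx]
    rw [h2, mul_zero]
    exact (hasDerivAt_const x (0 : ℝ)).congr_of_eventuallyEq h1
  · have h2 : truncPow (n + 1) 0 = 0 := by simp [truncPow]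
    rw [h2, mul_zero, hasDerivAt_iff_tendsto_slope]
    have h3 : Tendsto (truncPow (n + 1)) (𝓝[≠] 0) (𝓝 0) := by
      have := (continuous_truncPow_succ n).tendsto 0
      rw [h2] at this
      exact this.mono_left nhdsWithin_le_nhds
    refine h3.congr' ?_
    filter_upwards [self_mem_nhdsWithin] with y hy
    have hy' : y ≠ 0 := hy
    rw [slope_def_field, truncPow_succ (n + 1) y, truncPow_succ (n + 1) 0]
    field_simp
    simp
  · have h1 : truncPow (n + 2) =ᶠ[𝓝 x] fun y => y ^ (n + 2) := by
      filter_upwards [lt_mem_nhds hx] with y hy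
      simp [truncPow, hy.le]
    have h2 : truncPow (n + 1) x = x ^ (n + 1) := by simp [truncPow, hx.le]
    rw [h2]
    have := hasDerivAt_pow (n + 2) x
    push_cast at this
    exact this.congr_of_eventuallyEq h1

theorem contDiff_truncPow (n : ℕ) : ContDiff ℝ n (truncPow (n + 1)) := by
  induction n with
  | zero => exact contDiff_zero.2 (continuous_truncPow_succ 0)
  | succ n ih =>
    have : ((n + 1 : ℕ) : WithTop ℕ∞) = (n : WithTop ℕ∞) + 1 := by norm_cast
    rw [this, contDiff_succ_iff_deriv]
    refine ⟨fun x => (hasDerivAt_truncPow n x).differentiableAt, by simp, ?_⟩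
    have e : deriv (truncPow (n + 1 + 1)) = fun x => ((n : ℝ) + 2) * truncPow (n + 1) x := by
      funext x; exact (hasDerivAt_truncPow n x).deriv
    rw [e]
    exact contDiff_const.mul ih

open Classical in
/-- A smooth function that vanishes to infinite order on the boundary of `Ω` remains smooth when it
is replaced by `0` in `Ω`. Near the boundary the new function is `s * r₊ ^ N` with a smooth `s`, for
arbitrarily large `N`. -/
theorem contDiff_ite_mem_of_flat {Ω : Set ℂ} (hΩ : IsOpen Ω) {E r : ℂ → ℝ} (hE : ContDiff ℝ ∞ E)
    (hr : ContDiff ℝ ∞ r) (hside : ∀ p ∈ frontier Ω, ∀ᶠ z in 𝓝 p, z ∈ Ω ↔ r z < 0)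
    (hflat : ∀ p ∈ frontier Ω, ∀ N : ℕ, ∃ s : ℂ → ℝ, ContDiff ℝ ∞ s ∧
      ∀ᶠ z in 𝓝 p, E z = r z ^ N * s z) :
    ContDiff ℝ ∞ (fun z => if z ∈ Ω then 0 else E z) := by
  rw [contDiff_iff_contDiffAt]
  intro p
  by_cases hp : p ∈ frontier Ω
  · rw [contDiffAt_infty]
    intro n
    obtain ⟨s, hs, hEs⟩ := hflat p hp (n + 1)
    have heq : (fun z => if z ∈ Ω then 0 else E z) =ᶠ[𝓝 p]
        fun z => truncPow (n + 1) (r z) * s z := by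
      filter_upwards [hside p hp, hEs] with z h1 h2
      rw [truncPow, h2]
      simp only [h1]
      split_ifs <;> simp
    refine ContDiffAt.congr_of_eventuallyEq ?_ heq
    exact (((contDiff_truncPow n).comp (hr.of_le (natCast_le_infty n))).mul
      (hs.of_le (natCast_le_infty n))).contDiffAt
  · by_cases hpΩ : p ∈ Ω
    · refine contDiffAt_const (c := (0 : ℝ)).congr_of_eventuallyEq ?_
      filter_upwards [hΩ.mem_nhds hpΩ] with z hz
      simp [hz]
    · have hcl : p ∉ closure Ω := fun h => hp (by rw [hΩ.frontier_eq]; exact ⟨h, hpΩ⟩)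
      refine hE.contDiffAt.congr_of_eventuallyEq ?_
      filter_upwards [isClosed_closure.isOpen_compl.mem_nhds hcl] with z hz
      have : z ∉ Ω := fun h => hz (subset_closure h)
      simp [this]

/-! ### Schwarz functions with a simple pole at the origin -/

/-- If `∂φ/∂z = 1 / z - h` on the boundary, with `h` holomorphic in `Ω` and continuous up to the
boundary, then `1 / z - h` is a Schwarz function. -/
theorem isSchwarzFunction_inv_sub {Ω : Set ℂ} (hΩ : IsOpen Ω) (h0 : (0 : ℂ) ∈ Ω) {φ : ℂ → ℝ}
    {h : ℂ → ℂ} (hd : DifferentiableOn ℂ h Ω) (hc : ContinuousOn h (closure Ω))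
    (hφ : ∀ p ∈ frontier Ω, wirtingerDz φ p = 1 / p - h p) :
    IsSchwarzFunction Ω φ (fun z => 1 / z - h z) ∧
      HolomorphicExceptSimplePoleAtZero Ω (fun z => 1 / z - h z) := by
  have han : AnalyticOnNhd ℂ h Ω := hd.analyticOnNhd hΩ
  have hinv : ∀ z, MeromorphicAt (fun w : ℂ => 1 / w) z := fun z =>
    (MeromorphicAt.const 1 z).div (MeromorphicAt.id z)
  have hmer : MeromorphicOn (fun z => 1 / z - h z) Ω := fun z hz =>
    (hinv z).sub (han z hz).meromorphicAt
  refine ⟨⟨hmer, fun p hp => ?_, fun p hp => (hφ p hp).symm⟩, ?_, hmer 0 h0, ?_⟩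
  · have hp0 : p ≠ 0 := by
      rintro rfl
      rw [hΩ.frontier_eq] at hp
      exact hp.2 h0
    exact (continuousAt_const.div continuousAt_id hp0).continuousWithinAt.sub
      (hc p (frontier_subset_closure hp))
  · refine DifferentiableOn.sub ?_ (hd.mono sdiff_subset)
    exact (differentiableOn_const 1).div differentiableOn_id fun z hz => hz.2
  · have := (meromorphicOrderAt_eq_int_iff (n := -1) (hmer 0 h0)).2
      ⟨fun z => 1 - z * h z, analyticAt_const.sub (analyticAt_id.mul (han 0 h0)), by simp, by
        filter_upwards [self_mem_nhdsWithin] with z hz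
        have hz' : z ≠ 0 := hz
        simp only [sub_zero, zpow_neg, zpow_one, smul_eq_mul]
        field_simp⟩
    rw [this]
    rfl

theorem laplacian_add_log_norm {f : ℂ → ℝ} {z : ℂ} (hf : ContDiffAt ℝ 2 f z) (hz : z ≠ 0) :
    (Δ fun w => f w + 2 * Real.log ‖w‖) z = (Δ f) z := by
  have h1 : (Δ fun w => f w + 2 * Real.log ‖w‖) z = (Δ f) z + (Δ fun w : ℂ => 2 * Real.log ‖w‖) z :=
    ContDiffAt.laplacian_add hf (harmonicAt_log_normSq hz).1
  rw [h1, (harmonicAt_log_normSq hz).2.eq_of_nhds]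
  simp

theorem IsSmoothJordanDomain.isCompact_frontier {Ω : Set ℂ} (h : IsSmoothJordanDomain Ω) :
    IsCompact (frontier Ω) :=
  Metric.isCompact_of_isClosed_isBounded isClosed_frontier
    (h.2.2.1.closure.subset frontier_subset_closure)

/-- For merely smooth data, let `ψ` solve `Δ ψ = 1 / κ` near the boundary up to a flat error, with
zero Cauchy data, and let `u` be the potential of the exterior part of the error. Then
`φ = ψ - u + log |z|²` satisfies `Δ φ = 1 / κ` outside `Ω` and has the Schwarz function
`1 / z - ∂u/∂z`. -/
theorem exists_schwarz_of_smooth {Ω : Set ℂ} (hΩ : IsSmoothJordanDomain Ω) (h0 : (0 : ℂ) ∈ Ω)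
    {V : Set ℂ} (hV : IsOpen V) (hΩV : frontier Ω ⊆ V) {κ : ℂ → ℝ} (hκ : ContDiffOn ℝ ∞ κ V)
    (hκpos : ∀ z ∈ V, 0 < κ z) :
    ∃ (U : Set ℂ) (κ' φ : ℂ → ℝ) (S₀ : ℂ → ℂ),
      IsOpen U ∧ frontier Ω ⊆ U ∧ U ⊆ V ∧
      ContDiffOn ℝ ∞ κ' U ∧ (∀ z ∈ U, 0 < κ' z) ∧ (∀ z ∈ U \ Ω, κ' z = κ z) ∧
      ContDiffOn ℝ ∞ φ U ∧ (∀ z ∈ U, 0 < (Δ φ) z) ∧ (∀ z ∈ U, (Δ φ) z = 1 / κ' z) ∧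
      IsSchwarzFunction Ω φ S₀ ∧ HolomorphicExceptSimplePoleAtZero Ω S₀ := by
  have hopen := hΩ.1
  have hK := hΩ.isCompact_frontier
  obtain ⟨W, r₀, hW, hKW, hr₀, hr₀d, hr₀0, hr₀Ω⟩ := hΩ.exists_definingFunction
  -- The defining function and the density are made global by a cutoff `χ` that is `1` on `W₁`.
  obtain ⟨χ, hχ, hχc, hχs, hχ1⟩ := hK.exists_smooth_cutoff (hW.inter hV) (subset_inter hKW hΩV)
  obtain ⟨W₁', hW₁', hKW₁', hχW₁'⟩ := eventually_nhdsSet_iff_exists.1 hχ1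
  let W₁ : Set ℂ := W₁' ∩ (W ∩ V)
  have hW₁ : IsOpen W₁ := hW₁'.inter (hW.inter hV)
  have hKW₁ : frontier Ω ⊆ W₁ := subset_inter hKW₁' (subset_inter hKW hΩV)
  have hχW₁ : ∀ z ∈ W₁, χ z = 1 := fun z hz => hχW₁' z hz.1
  let r : ℂ → ℝ := fun z => χ z * r₀ z
  have hr : ContDiff ℝ ∞ r := hχ.mul_of_tsupport_subset hW (hχs.trans inter_subset_left) hr₀
  have hrc : HasCompactSupport r := hχc.mul_right
  have hrW₁ : ∀ z ∈ W₁, r z = r₀ z := fun z hz => by simp [r, hχW₁ z hz]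
  have hrd : ∀ z ∈ W₁, fderiv ℝ r z = fderiv ℝ r₀ z := fun z hz => by
    refine Filter.EventuallyEq.fderiv_eq ?_
    filter_upwards [hW₁.mem_nhds hz] with w hw using hrW₁ w hw
  let ρ : ℂ → ℝ := fun z => χ z * (1 / κ z)
  have hρ : ContDiff ℝ ∞ ρ := hχ.mul_of_tsupport_subset hV (hχs.trans inter_subset_right)
    (contDiffOn_const.div hκ fun z hz => (hκpos z hz).ne')
  have hρW₁ : ∀ z ∈ W₁, ρ z = 1 / κ z := fun z hz => by simp [ρ, hχW₁ z hz]
  have hρpos : ∀ z ∈ W₁, 0 < ρ z := fun z hz => by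
    rw [hρW₁ z hz]; exact one_div_pos.2 (hκpos z hz.2.2)
  let q : ℂ → ℝ := fun z => χ z * (1 / gradSq r₀ z)
  have hG : ContDiffOn ℝ ∞ (gradSq r₀) W := by
    have h1 := (hr₀.fderiv_of_isOpen hW (m := ∞) (by simp))
    exact ((h1.clm_apply contDiffOn_const).pow 2).add ((h1.clm_apply contDiffOn_const).pow 2)
  have hGpos : ∀ z ∈ W, 0 < gradSq r₀ z := fun z hz => gradSq_pos (hr₀d z hz)
  have hq : ContDiff ℝ ∞ q := hχ.mul_of_tsupport_subset hW (hχs.trans inter_subset_left)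
    (contDiffOn_const.div hG fun z hz => (hGpos z hz).ne')
  have hqW₁ : ∀ z ∈ W₁, q z * gradSq r z = 1 := fun z hz => by
    have h1 : gradSq r z = gradSq r₀ z := by simp only [gradSq, hrd z hz]
    rw [h1]
    simp only [q, hχW₁ z hz, one_mul]
    exact one_div_mul_cancel (hGpos z hz.2.1).ne'
  have hr0 : ∀ p ∈ frontier Ω, r p = 0 := fun p hp => by
    rw [hrW₁ p (hKW₁ hp)]; exact (hr₀0 p (hKW hp)).1 hp
  have hside : ∀ p ∈ frontier Ω, ∀ᶠ z in 𝓝 p, z ∈ Ω ↔ r z < 0 := fun p hp => by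
    filter_upwards [hW₁.mem_nhds (hKW₁ hp)] with z hz
    rw [hrW₁ z hz, hr₀Ω z hz.2.1]
  obtain ⟨ψ, hψ, hψd, hψflat⟩ := exists_cauchy_solution_mod_flat hr hrc hρ hq hχc.mul_right hqW₁
  -- The error is flat on the boundary; its restriction to the exterior is removed by `u`, which
  -- is harmonic in `Ω`.
  obtain ⟨χ₂, hχ₂, hχ₂c, hχ₂s, hχ₂1⟩ := hK.exists_smooth_cutoff hW₁ hKW₁
  obtain ⟨W₂, hW₂, hKW₂, hχW₂⟩ := eventually_nhdsSet_iff_exists.1 hχ₂1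
  let E : ℂ → ℝ := fun z => χ₂ z * ((Δ ψ) z - ρ z)
  have hE : ContDiff ℝ ∞ E := hχ₂.mul (hψ.laplacian.sub hρ)
  have hflat : ∀ p ∈ frontier Ω, ∀ N : ℕ, ∃ s : ℂ → ℝ, ContDiff ℝ ∞ s ∧
      ∀ᶠ z in 𝓝 p, E z = r z ^ N * s z := by
    intro p hp N
    obtain ⟨s, hs, δ, hδ, hδs⟩ := hψflat N
    refine ⟨fun z => χ₂ z * s z, hχ₂.mul hs, ?_⟩
    have hrp : {z | |r z| < δ} ∈ 𝓝 p :=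
      (isOpen_lt hr.continuous.abs continuous_const).mem_nhds (by
        rw [mem_ofPred_eq, hr0 p hp, abs_zero]; exact hδ)
    filter_upwards [hrp, hW₁.mem_nhds (hKW₁ hp)] with z h1 h2
    simp only [E]
    rw [hδs z h2 h1]
    ring
  classical
  let F : ℂ → ℝ := fun z => if z ∈ Ω then 0 else E z
  have hF : ContDiff ℝ ∞ F := contDiff_ite_mem_of_flat hopen hE hr hside hflat
  have hFc : HasCompactSupport F := by
    refine (hχ₂c.mul_right (f' := fun z => (Δ ψ) z - ρ z)).mono fun z hz => ?_
    rw [Function.mem_support] at hz ⊢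
    intro h
    apply hz
    simp only [F]
    split_ifs
    · rfl
    · exact h
  obtain ⟨u, hu, hΔu⟩ := exists_contDiff_laplacian_eq hF hFc
  have hΔψpos : ∀ p ∈ frontier Ω, 0 < (Δ ψ) p := by
    intro p hp
    obtain ⟨s, -, δ, hδ, hδs⟩ := hψflat 1
    have := hδs p (hKW₁ hp) (by rw [hr0 p hp, abs_zero]; exact hδ)
    rw [hr0 p hp, pow_one, zero_mul, sub_eq_zero] at this
    rw [this]
    exact hρpos p (hKW₁ hp)
  let U : Set ℂ := ((W₂ ∩ W₁) ∩ {0}ᶜ) ∩ {z | 0 < (Δ ψ) z}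
  have hU : IsOpen U := ((hW₂.inter hW₁).inter isOpen_compl_singleton).inter
    (isOpen_lt continuous_const hψ.laplacian.continuous)
  have hne0 : ∀ p ∈ frontier Ω, p ≠ 0 := by
    rintro p hp rfl
    rw [hopen.frontier_eq] at hp
    exact hp.2 h0
  have hKU : frontier Ω ⊆ U := fun p hp => ⟨⟨⟨hKW₂ hp, hKW₁ hp⟩, hne0 p hp⟩, hΔψpos p hp⟩
  let φ : ℂ → ℝ := fun z => (ψ z - u z) + 2 * Real.log ‖z‖
  have hψu : ContDiff ℝ ∞ (fun z => ψ z - u z) := hψ.sub hu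
  have hΔφ : ∀ z ∈ U, (Δ φ) z = (Δ ψ) z - F z := by
    intro z hz
    have h1 : (Δ φ) z = (Δ fun z => ψ z - u z) z :=
      laplacian_add_log_norm (hψu.contDiffAt.of_le (by norm_cast)) hz.1.2
    have h2 : (Δ fun z => ψ z - u z) z = (Δ ψ) z - (Δ u) z :=
      ContDiffAt.laplacian_sub (hψ.contDiffAt.of_le (by norm_cast))
        (hu.contDiffAt.of_le (by norm_cast))
    rw [h1, h2, hΔu]
  have hext : ∀ z ∈ U \ Ω, (Δ ψ) z - F z = 1 / κ z := by
    intro z hz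
    have h1 : F z = χ₂ z * ((Δ ψ) z - ρ z) := if_neg hz.2
    rw [h1, hχW₂ z hz.1.1.1.1, hρW₁ z hz.1.1.1.2]
    ring
  have hpos : ∀ z ∈ U, 0 < (Δ ψ) z - F z := by
    intro z hz
    by_cases hzΩ : z ∈ Ω
    · have h1 : F z = 0 := if_pos hzΩ
      rw [h1, sub_zero]
      exact hz.2
    · rw [hext z ⟨hz, hzΩ⟩]
      exact one_div_pos.2 (hκpos z hz.1.1.2.2.2)
  have huharm : ∀ z ∈ Ω, InnerProductSpace.HarmonicAt u z := by
    intro z hz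
    refine ⟨hu.contDiffAt.of_le (by norm_cast), ?_⟩
    filter_upwards [hopen.mem_nhds hz] with w hw
    rw [hΔu]
    exact if_pos hw
  obtain ⟨hS, hS'⟩ := isSchwarzFunction_inv_sub (φ := φ) hopen h0
    (h := wirtingerDz u)
    (fun z hz => (wirtingerDz_differentiable (huharm z hz)).differentiableWithinAt)
    (wirtingerDz_contDiff hu).continuous.continuousOn (fun p hp => by
      have hd : ∀ {f : ℂ → ℝ}, ContDiff ℝ ∞ f → DifferentiableAt ℝ f p := fun hf =>
        hf.differentiable (by simp) p
      have h1 : wirtingerDz φ p = _ := wirtingerDz_add (hd hψu)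
        ((contDiffAt_log_norm (hne0 p hp)).differentiableAt (by simp))
      rw [h1, wirtingerDz_sub (hd hψ) (hd hu), wirtingerDz_eq_zero_iff.2 (hψd p (hr0 p hp)),
        wirtingerDz_log_norm (hne0 p hp)]
      ring)
  refine ⟨U, fun z => 1 / ((Δ ψ) z - F z), φ, _, hU, hKU, fun z hz => hz.1.1.2.2.2, ?_,
    fun z hz => one_div_pos.2 (hpos z hz), fun z hz => by
      beta_reduce
      rw [hext z hz, one_div_one_div], ?_,
    fun z hz => by rw [hΔφ z hz]; exact hpos z hz,
    fun z hz => by rw [hΔφ z hz, one_div_one_div], hS, hS'⟩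
  · exact contDiffOn_const.div (hψ.laplacian.sub hF).contDiffOn fun z hz => (hpos z hz).ne'
  · intro z hz
    exact (hψu.contDiffAt.add (contDiffAt_log_norm hz.1.2)).contDiffWithinAt

/-! ### Real analytic functions as series in `z` and its conjugate -/

theorem summable_of_norm_le_mul_pow {ι : Type} {c : ι → ℂ} {a b : ι → ℕ} {δ : ℝ} (hδ : 0 < δ)
    (hs : Summable fun i => ‖c i‖ * δ ^ (a i + b i)) {z w : ℂ} (hz : ‖z‖ ≤ δ) (hw : ‖w‖ ≤ δ) :
    Summable fun i => c i * (z ^ a i * w ^ b i) := by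
  refine Summable.of_norm_bounded hs fun i => ?_
  rw [norm_mul, norm_mul, norm_pow, norm_pow, pow_add]
  gcongr

open ComplexConjugate in
/-- The term of degree `n` of a real power series in the plane, as a polynomial in `z` and its
conjugate. -/
theorem multilinear_diag_eq_sum (n : ℕ) (q : ContinuousMultilinearMap ℝ (fun _ : Fin n => ℂ) ℝ) :
    ∃ c : (Fin n → Fin 2) × (Fin n → Fin 2) → ℂ,
      (∀ i, ‖c i‖ ≤ (1 / 2) ^ n * ‖q‖) ∧ ∀ z : ℂ, (q (fun _ => z) : ℂ) =
        ∑ i : (Fin n → Fin 2) × (Fin n → Fin 2), c i *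
          (z ^ (Finset.univ.filter fun j => i.2 j = 0).card *
            conj z ^ (Finset.univ.filter fun j => ¬ i.2 j = 0).card) := by
  let e : Fin 2 → ℂ := ![1, Complex.I]
  let A : Fin 2 → Fin 2 → ℂ := ![![1 / 2, 1 / 2], ![-Complex.I / 2, Complex.I / 2]]
  have he : ∀ d, ‖e d‖ = 1 := fun d => by fin_cases d <;> simp [e]
  have hA : ∀ d s, ‖A d s‖ = 1 / 2 := fun d s => by fin_cases d <;> fin_cases s <;> simp [A]
  refine ⟨fun i => (∏ j, A (i.1 j) (i.2 j)) * (q (fun j => e (i.1 j)) : ℂ), fun i => ?_,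
    fun z => ?_⟩
  · rw [norm_mul, norm_prod]
    simp only [hA, Finset.prod_const, Finset.card_univ, Fintype.card_fin]
    refine mul_le_mul_of_nonneg_left ?_ (by positivity)
    rw [Complex.norm_real]
    refine (q.le_opNorm _).trans ?_
    simp [he]
  · let x : Fin 2 → ℝ := ![z.re, z.im]
    have hz : z = ∑ d, x d • e d := by
      rw [Fin.sum_univ_two]
      apply Complex.ext <;> simp [x, e]
    have hx : ∀ d, (x d : ℂ) = ∑ s, A d s * (if s = 0 then z else conj z) := by
      intro d
      rw [Fin.sum_univ_two]
      fin_cases d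
      · apply Complex.ext <;> simp [x, A] <;> ring
      · apply Complex.ext <;> simp [x, A] <;> ring
    have h1 : q (fun _ => z) = ∑ d : Fin n → Fin 2, (∏ j, x (d j)) * q (fun j => e (d j)) := by
      conv_lhs => rw [hz]
      have := q.toMultilinearMap.map_sum (fun (_ : Fin n) (d : Fin 2) => x d • e d)
      simp only [ContinuousMultilinearMap.coe_coe] at this
      rw [this]
      refine Finset.sum_congr rfl fun d _ => ?_
      rw [q.map_smul_univ (fun j => x (d j)) (fun j => e (d j)), smul_eq_mul]
    rw [h1, Fintype.sum_prod_type]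
    push_cast
    refine Finset.sum_congr rfl fun d _ => ?_
    simp only [hx]
    rw [Finset.prod_univ_sum, Fintype.piFinset_univ, Finset.sum_mul]
    refine Finset.sum_congr rfl fun s _ => ?_
    rw [Finset.prod_mul_distrib, Finset.prod_ite, Finset.prod_const, Finset.prod_const]
    ring

open ComplexConjugate in
/-- A real analytic function of a complex variable `z` is locally the sum of an absolutely
convergent series of monomials in `z` and its conjugate. -/
theorem AnalyticAt.exists_series_conj {ρ : ℂ → ℝ} {p : ℂ} (hρ : AnalyticAt ℝ ρ p) :
    ∃ (ι : Type) (c : ι → ℂ) (a b : ι → ℕ) (δ : ℝ), 0 < δ ∧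
      (Summable fun i => ‖c i‖ * δ ^ (a i + b i)) ∧
      ∀ z : ℂ, ‖z‖ < δ → HasSum (fun i => c i * (z ^ a i * conj z ^ b i)) (ρ (p + z) : ℂ) := by
  obtain ⟨q, R, hq⟩ := hρ
  have hR : (0 : ENNReal) < q.radius := hq.r_pos.trans_le hq.r_le
  obtain ⟨R₁, hR₁0, hR₁⟩ := ENNReal.lt_iff_exists_nnreal_btwn.1 (lt_min hR hq.r_pos)
  have hR₁0' : 0 < (R₁ : ℝ) := by exact_mod_cast hR₁0
  have hsum := q.summable_norm_mul_pow (hR₁.trans_le (min_le_left _ _))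
  choose c hc hcq using fun n => multilinear_diag_eq_sum n (q n)
  let ι := Σ n : ℕ, (Fin n → Fin 2) × (Fin n → Fin 2)
  let a : ι → ℕ := fun i => (Finset.univ.filter fun j => i.2.2 j = 0).card
  let b : ι → ℕ := fun i => (Finset.univ.filter fun j => ¬ i.2.2 j = 0).card
  have hab : ∀ i : ι, a i + b i = i.1 := fun i => by
    have := Finset.card_filter_add_card_filter_not (s := (Finset.univ : Finset (Fin i.1)))
      (fun j => i.2.2 j = 0)
    simpa using this
  have hS : Summable fun i : ι => ‖c i.1 i.2‖ * ((R₁ : ℝ) / 2) ^ (a i + b i) := by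
    rw [summable_sigma_of_nonneg (fun i => by positivity)]
    refine ⟨fun n => (hasSum_fintype _).summable, ?_⟩
    refine Summable.of_nonneg_of_le (fun n => tsum_nonneg fun i => by positivity) (fun n => ?_) hsum
    rw [tsum_fintype]
    calc ∑ i : (Fin n → Fin 2) × (Fin n → Fin 2), ‖c n i‖ * ((R₁ : ℝ) / 2) ^ (a ⟨n, i⟩ + b ⟨n, i⟩)
        ≤ ∑ _i : (Fin n → Fin 2) × (Fin n → Fin 2),
            (1 / 2) ^ n * ‖q n‖ * ((R₁ : ℝ) / 2) ^ n := by
          refine Finset.sum_le_sum fun i _ => ?_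
          rw [hab ⟨n, i⟩]
          exact mul_le_mul_of_nonneg_right (hc n i) (by positivity)
      _ = ‖q n‖ * (R₁ : ℝ) ^ n := by
          rw [Finset.sum_const, Finset.card_univ, Fintype.card_prod, Fintype.card_fun,
            Fintype.card_fin, Fintype.card_fin, nsmul_eq_mul, div_pow, div_pow]
          push_cast
          field_simp
          rw [one_pow, one_mul]
  refine ⟨ι, fun i => c i.1 i.2, a, b, (R₁ : ℝ) / 2, by positivity, hS, fun z hz => ?_⟩
  have hzs := (summable_of_norm_le_mul_pow (by positivity) hS hz.le
    (w := conj z) (by rw [RCLike.norm_conj]; exact hz.le)).hasSum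
  have h1 := hzs.sigma fun n => hasSum_fintype _
  have hzR : z ∈ Metric.eball (0 : ℂ) R := by
    have h3 : ‖z‖ < R₁ := by linarith
    rw [Metric.mem_eball, edist_zero_right]
    refine lt_trans ?_ (hR₁.trans_le (min_le_right _ _))
    rw [enorm_eq_nnnorm]
    exact_mod_cast h3
  have h2 := (hq.hasSum hzR).mapL Complex.ofRealCLM
  have h3 : HasSum (fun n => ((q n fun _ => z : ℝ) : ℂ)) (ρ (p + z) : ℂ) := h2
  simp only [hcq] at h3
  have := h3.unique h1
  rw [this]
  exact hzs

/-- The formal primitive `∑ c z ^ a w ^ (b + 1) / (b + 1)` of `∑ c z ^ a w ^ b` in the second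
variable. -/
noncomputable def seriesPrimitive {ι : Type} (c : ι → ℂ) (a b : ι → ℕ) (z w : ℂ) : ℂ :=
  ∑' i, c i * (z ^ a i * w ^ (b i + 1) / (b i + 1))

section SeriesPrimitive

variable {ι : Type} {c : ι → ℂ} {a b : ι → ℕ} {δ : ℝ}

theorem norm_natCast_add_one_ge (n : ℕ) : 1 ≤ ‖((n : ℂ) + 1)‖ := by
  have : ((n : ℂ) + 1) = ((n + 1 : ℕ) : ℂ) := by push_cast; rfl
  rw [this, Complex.norm_natCast]
  exact_mod_cast Nat.succ_pos n

theorem norm_seriesPrimitive_term_le (hδ : 0 < δ) {z w : ℂ} (hz : ‖z‖ ≤ δ) (hw : ‖w‖ ≤ δ) (i : ι) :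
    ‖c i * (z ^ a i * w ^ (b i + 1) / (b i + 1))‖ ≤ ‖c i‖ * δ ^ (a i + b i) * δ := by
  rw [norm_mul, norm_div, norm_mul, norm_pow, norm_pow, mul_assoc]
  refine mul_le_mul_of_nonneg_left ?_ (norm_nonneg _)
  refine (div_le_self (by positivity) (norm_natCast_add_one_ge _)).trans ?_
  have : δ ^ (a i + b i) * δ = δ ^ a i * δ ^ (b i + 1) := by ring
  rw [this]
  gcongr

theorem analyticAt_seriesPrimitive_comp (hδ : 0 < δ)
    (hs : Summable fun i => ‖c i‖ * δ ^ (a i + b i)) {H K : ℂ → ℂ} (hH : AnalyticAt ℂ H 0)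
    (hK : AnalyticAt ℂ K 0) (hH0 : H 0 = 0) (hK0 : K 0 = 0) :
    AnalyticAt ℂ (fun t => seriesPrimitive c a b (H t) (K t)) 0 := by
  have hev : ∀ {G : ℂ → ℂ}, AnalyticAt ℂ G 0 → G 0 = 0 →
      ∀ᶠ t in 𝓝 (0 : ℂ), DifferentiableAt ℂ G t ∧ ‖G t‖ < δ := fun {G} hG hG0 => by
    refine (hG.eventually_analyticAt.mono fun t ht => ht.differentiableAt).and ?_
    have : Tendsto (fun t => ‖G t‖) (𝓝 0) (𝓝 0) := by
      have := hG.continuousAt.norm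
      rwa [ContinuousAt, hG0, norm_zero] at this
    exact this.eventually (gt_mem_nhds hδ)
  obtain ⟨s, hs1, hsopen, h0s⟩ := eventually_nhds_iff.1 ((hev hH hH0).and (hev hK hK0))
  refine DifferentiableOn.analyticAt (s := s) ?_ (hsopen.mem_nhds h0s)
  refine Complex.differentiableOn_tsum_of_summable_norm (hs.mul_right δ) (fun i => ?_) hsopen
    fun i t ht => norm_seriesPrimitive_term_le hδ (hs1 t ht).1.2.le (hs1 t ht).2.2.le i
  intro t ht
  exact ((((hs1 t ht).1.1.pow _).mul ((hs1 t ht).2.1.pow _)).div_const _).const_mul _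
    |>.differentiableWithinAt

open ComplexConjugate in
/-- Substituting the conjugate of `z` for the second variable, `seriesPrimitive` becomes a primitive
with respect to `∂/∂z̄ = (∂_x + i ∂_y) / 2`. -/
theorem hasFDerivAt_seriesPrimitive_conj (hδ : 0 < δ)
    (hs : Summable fun i => ‖c i‖ * δ ^ (a i + b i)) {z : ℂ} (hz : ‖z‖ < δ / 2) :
    ∃ L : ℂ →L[ℝ] ℂ, HasFDerivAt (fun z => seriesPrimitive c a b z (conj z)) L z ∧
      L 1 + Complex.I * L Complex.I = 2 * ∑' i, c i * (z ^ a i * conj z ^ b i) := by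
  let D : ι → ℂ → ℂ →L[ℝ] ℂ := fun i z =>
    (c i * (a i * z ^ (a i - 1) * conj z ^ (b i + 1) / (b i + 1))) •
        (ContinuousLinearMap.id ℝ ℂ) +
      (c i * (z ^ a i * conj z ^ b i)) • (Complex.conjCLE : ℂ →L[ℝ] ℂ)
  have hD : ∀ i z, HasFDerivAt (fun z => c i * (z ^ a i * conj z ^ (b i + 1) / (b i + 1)))
      (D i z) z := by
    intro i z
    have h1 : HasFDerivAt (fun z : ℂ => z ^ a i) _ z := (hasFDerivAt_id (𝕜 := ℝ) z).pow (a i)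
    have h2 : HasFDerivAt (fun z : ℂ => conj z ^ (b i + 1)) _ z :=
      (Complex.conjCLE.hasFDerivAt (x := z)).pow (b i + 1)
    have h3 := ((h1.mul h2).mul_const ((b i : ℂ) + 1)⁻¹).const_mul (c i)
    have hb : ((b i : ℂ) + 1) ≠ 0 := by exact_mod_cast Nat.succ_ne_zero (b i)
    convert! h3 using 1
    ext v
    simp [D]
    field_simp
    ring
  have hDle : ∀ i, ∀ z ∈ Metric.ball (0 : ℂ) (δ / 2), ‖D i z‖ ≤ ‖c i‖ * δ ^ (a i + b i) := by
    intro i z hz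
    rw [mem_ball_zero_iff] at hz
    have hz2 : ‖z‖ ^ (a i + b i) ≤ (δ / 2) ^ (a i + b i) := pow_le_pow_left₀ (norm_nonneg _) hz.le _
    have hA : ‖(a i : ℂ) * z ^ (a i - 1) * conj z ^ (b i + 1) / (b i + 1)‖ ≤
        a i * (δ / 2) ^ (a i + b i) := by
      rw [norm_div, norm_mul, norm_mul, norm_pow, norm_pow, RCLike.norm_conj, Complex.norm_natCast]
      refine (div_le_self (by positivity) (norm_natCast_add_one_ge _)).trans ?_
      rcases Nat.eq_zero_or_pos (a i) with h0 | h0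
      · simp [h0]
      · rw [mul_assoc, ← pow_add]
        have : a i - 1 + (b i + 1) = a i + b i := by omega
        rw [this]
        gcongr
    have hB : ‖z ^ a i * conj z ^ b i‖ ≤ (δ / 2) ^ (a i + b i) := by
      rw [norm_mul, norm_pow, norm_pow, RCLike.norm_conj, ← pow_add]
      exact hz2
    have hle : ((a i : ℝ) + 1) * (δ / 2) ^ (a i + b i) ≤ δ ^ (a i + b i) := by
      rw [div_pow, mul_div_assoc', div_le_iff₀ (by positivity), mul_comm]
      refine mul_le_mul_of_nonneg_left ?_ (by positivity)
      have h1 : a i + 1 ≤ 2 ^ (a i + b i) :=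
        (Nat.succ_le_of_lt Nat.lt_two_pow_self).trans
          (Nat.pow_le_pow_right (by norm_num) (Nat.le_add_right _ _))
      exact_mod_cast h1
    have hn1 : ‖(ContinuousLinearMap.id ℝ ℂ)‖ ≤ 1 := ContinuousLinearMap.norm_id_le
    have hn2 : ‖(Complex.conjCLE : ℂ →L[ℝ] ℂ)‖ ≤ 1 := by
      refine ContinuousLinearMap.opNorm_le_bound _ zero_le_one fun v => ?_
      simp
    calc ‖D i z‖ ≤ ‖c i * (a i * z ^ (a i - 1) * conj z ^ (b i + 1) / (b i + 1))‖ * 1 +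
          ‖c i * (z ^ a i * conj z ^ b i)‖ * 1 := by
          refine (norm_add_le _ _).trans ?_
          rw [norm_smul, norm_smul]
          gcongr
      _ ≤ ‖c i‖ * (a i * (δ / 2) ^ (a i + b i)) + ‖c i‖ * (δ / 2) ^ (a i + b i) := by
          rw [mul_one, mul_one, norm_mul, norm_mul (c i)]
          gcongr
      _ = ‖c i‖ * (((a i : ℝ) + 1) * (δ / 2) ^ (a i + b i)) := by ring
      _ ≤ _ := by gcongr
  have hmem : z ∈ Metric.ball (0 : ℂ) (δ / 2) := by rwa [mem_ball_zero_iff]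
  have h0 : (0 : ℂ) ∈ Metric.ball (0 : ℂ) (δ / 2) := Metric.mem_ball_self (by positivity)
  refine ⟨∑' i, D i z, ?_, ?_⟩
  · refine hasFDerivAt_tsum_of_isPreconnected hs Metric.isOpen_ball
      (convex_ball _ _).isPreconnected (fun i x _ => hD i x) hDle h0 ?_ hmem
    refine Summable.congr summable_zero fun i => ?_
    simp
  · have hsumD : HasSum (fun i => D i z) (∑' i, D i z) :=
      (Summable.of_norm_bounded hs fun i => hDle i z hmem).hasSum
    have e1 := hsumD.mapL (ContinuousLinearMap.apply ℝ ℂ (1 : ℂ))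
    have e2 := (hsumD.mapL (ContinuousLinearMap.apply ℝ ℂ Complex.I)).mul_left Complex.I
    have e3 := e1.add e2
    have hzs := (summable_of_norm_le_mul_pow (z := z) (w := conj z) hδ hs (by linarith)
      (by rw [RCLike.norm_conj]; linarith)).hasSum.mul_left 2
    refine e3.unique ?_
    convert! hzs using 1
    funext i
    simp [D]
    linear_combination (- c i * (a i * z ^ (a i - 1) * conj z ^ (b i + 1) / (b i + 1)) * (-1) -
      c i * (z ^ a i * conj z ^ b i)) * Complex.I_mul_I

end SeriesPrimitive

/-! ### Holomorphic extension from a real analytic curve -/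

theorem fderiv_wirtingerDz {u : ℂ → ℝ} (hu : ContDiff ℝ ∞ u) (z : ℂ) :
    fderiv ℝ (wirtingerDz u) z 1 + Complex.I * fderiv ℝ (wirtingerDz u) z Complex.I =
      ((Δ u) z : ℂ) / 2 := by
  have hA : ∀ v, HasFDerivAt (fun w => (fderiv ℝ u w v : ℂ))
      (Complex.ofRealCLM.comp (fderiv ℝ (fun w => fderiv ℝ u w v) z)) z := fun v =>
    Complex.ofRealCLM.hasFDerivAt.comp z
      ((hu.fderiv_apply_const v).differentiable (by simp) z).hasFDerivAt
  have hW : HasFDerivAt (wirtingerDz u) _ z :=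
    ((hA 1).sub ((hA Complex.I).const_mul Complex.I)).mul_const (2⁻¹ : ℂ)
  have hd : DifferentiableAt ℝ (fderiv ℝ u) z :=
    (hu.fderiv_right (m := ∞) (by simp)).differentiable (by simp) z
  have hsymm : fderiv ℝ (fun w => fderiv ℝ u w 1) z Complex.I =
      fderiv ℝ (fun w => fderiv ℝ u w Complex.I) z 1 := by
    rw [fderiv_clm_apply hd (by fun_prop), fderiv_clm_apply hd (by fun_prop)]
    have := (hu.contDiffAt (x := z)).isSymmSndFDerivAt
      (by rw [minSmoothness_of_isRCLikeNormedField]; norm_cast) |>.eq Complex.I 1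
    simpa using this
  rw [hW.fderiv, laplacian_eq_fderiv_fderiv (hu.contDiffAt.of_le (by norm_cast))]
  simp
  rw [hsymm]
  linear_combination (-(1 / 2 : ℂ) * (fderiv ℝ (fun w => fderiv ℝ u w Complex.I) z Complex.I : ℂ)) *
    Complex.I_mul_I

/-- A real analytic function of a real variable extends holomorphically. -/
theorem AnalyticAt.exists_holomorphic_extension {f : ℝ → ℝ} (hf : AnalyticAt ℝ f 0) :
    ∃ F : ℂ → ℂ, AnalyticAt ℂ F 0 ∧ ∀ᶠ x : ℝ in 𝓝 0, F x = f x := by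
  obtain ⟨q, R, hq⟩ := hf
  have hR : (0 : ENNReal) < q.radius := hq.r_pos.trans_le hq.r_le
  obtain ⟨R₁, hR₁0, hR₁⟩ := ENNReal.lt_iff_exists_nnreal_btwn.1 hR
  have hR₁0' : 0 < (R₁ : ℝ) := by exact_mod_cast hR₁0
  have hsum := q.summable_norm_mul_pow hR₁
  refine ⟨fun z => ∑' n, (q.coeff n : ℂ) * z ^ n, ?_, ?_⟩
  · refine DifferentiableOn.analyticAt (s := Metric.ball 0 (R₁ : ℝ)) ?_
      (Metric.ball_mem_nhds _ hR₁0')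
    refine Complex.differentiableOn_tsum_of_summable_norm hsum (fun n => ?_) Metric.isOpen_ball
      fun n z hz => ?_
    · exact ((differentiable_id.pow n).const_mul _).differentiableOn
    · rw [norm_mul, norm_pow, Complex.norm_real]
      have h1 : ‖q.coeff n‖ ≤ ‖q n‖ := by
        refine ((q n).le_opNorm _).trans ?_
        simp
      have h2 := (mem_ball_zero_iff.1 hz).le
      gcongr
  · have hev : Metric.eball (0 : ℝ) R ∈ 𝓝 0 := Metric.eball_mem_nhds _ hq.r_pos
    filter_upwards [hev] with x hx
    have h1 := (hq.hasSum hx).mapL Complex.ofRealCLM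
    rw [zero_add] at h1
    refine HasSum.tsum_eq ?_
    convert! h1 using 1
    funext n
    simp [mul_comm]

/-- The holomorphic extension of a real valued function has a real derivative. -/
theorem im_deriv_eq_zero_of_real {F : ℂ → ℂ} {f : ℝ → ℝ} (hF : AnalyticAt ℂ F 0)
    (hf : AnalyticAt ℝ f 0) (hFf : ∀ᶠ x : ℝ in 𝓝 0, F x = f x) : (deriv F 0).im = 0 := by
  have h1 : HasDerivAt F (deriv F 0) ((0 : ℝ) : ℂ) := by
    simpa using hF.differentiableAt.hasDerivAt
  have h2 : HasDerivAt (fun x : ℝ => F x) (deriv F 0) 0 := h1.comp_ofReal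
  have h3 : HasDerivAt (fun x : ℝ => (f x : ℂ)) ((deriv f 0 : ℝ) : ℂ) 0 :=
    hf.differentiableAt.hasDerivAt.ofReal_comp
  rw [h2.unique (h3.congr_of_eventuallyEq hFf)]
  simp

open ComplexConjugate in
/-- Let `Δ u` be real analytic near `p`. Along a real analytic curve through `p`, the function
`∂u/∂z` extends holomorphically to a neighbourhood of `p`: up to a holomorphic function it is a
power series in `z` and its conjugate, and on the curve the conjugate of `z` is a holomorphic
function of the complexified curve parameter. -/
theorem exists_holomorphic_extension_wirtingerDz {u ρ : ℂ → ℝ} (hu : ContDiff ℝ ∞ u) {p : ℂ}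
    (hΔ : ∀ᶠ z in 𝓝 p, (Δ u) z = ρ z) (hρ : AnalyticAt ℝ ρ p) {e : ℂ} (he : e ≠ 0) {f : ℝ → ℝ}
    (hf : AnalyticAt ℝ f 0) (hf0 : f 0 = 0) :
    ∃ h : ℂ → ℂ, AnalyticAt ℂ h p ∧ ∀ᶠ x : ℝ in 𝓝 0,
      h (p + e * (x + f x * Complex.I)) = wirtingerDz u (p + e * (x + f x * Complex.I)) := by
  obtain ⟨ι, c, a, b, δ, hδ, hs, hsum⟩ := hρ.exists_series_conj
  obtain ⟨F, hF, hFf⟩ := hf.exists_holomorphic_extension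
  have hF0 : F 0 = 0 := by
    have := hFf.self_of_nhds
    rw [hf0] at this
    simpa using this
  let P : ℂ → ℂ → ℂ := seriesPrimitive c a b
  -- The part of `∂u/∂z` that is holomorphic near `p`: since `Δ u = 4 ∂²u/∂z̄∂z`, a quarter of
  -- `P` is a primitive of `∂²u/∂z̄∂z` with respect to `∂/∂z̄`.
  let h₁ : ℂ → ℂ := fun z => wirtingerDz u z - P (z - p) (conj (z - p)) * 4⁻¹
  have hh₁ : AnalyticAt ℂ h₁ p := by
    obtain ⟨s, hs1, hsopen, hps⟩ := eventually_nhds_iff.1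
      (hΔ.and (Metric.ball_mem_nhds p (half_pos hδ)))
    refine DifferentiableOn.analyticAt (s := s) (fun z hz => ?_) (hsopen.mem_nhds hps)
    have hz2 : ‖z - p‖ < δ / 2 := by
      have := (hs1 z hz).2
      rwa [dist_eq_norm] at this
    obtain ⟨L, hL, hL1⟩ := hasFDerivAt_seriesPrimitive_conj hδ hs hz2
    have hL' : HasFDerivAt (fun z => P (z - p) (conj (z - p))) L z := by
      have := hL.comp z ((hasFDerivAt_id (𝕜 := ℝ) z).sub_const p)
      rw [ContinuousLinearMap.comp_id] at this
      exact this
    have hW := ((wirtingerDz_contDiff hu).differentiable (by simp) z).hasFDerivAt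
    have hh : HasFDerivAt h₁ _ z := hW.sub (hL'.mul_const (4⁻¹ : ℂ))
    refine (differentiableAt_complex_iff_differentiableAt_real.2
      ⟨hh.differentiableAt, ?_⟩).differentiableWithinAt
    have hW1 := fderiv_wirtingerDz hu z
    have hval : ∑' i, c i * ((z - p) ^ a i * conj (z - p) ^ b i) = ((Δ u) z : ℂ) := by
      rw [(hsum (z - p) (by linarith)).tsum_eq, (hs1 z hz).1]
      congr 2
      ring
    rw [hval] at hL1
    rw [hh.fderiv]
    simp
    linear_combination (-Complex.I) * hW1 + Complex.I / 4 * hL1 +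
      (fderiv ℝ (wirtingerDz u) z Complex.I - L Complex.I / 4) * Complex.I_mul_I
  -- The complexified curve and the reflected curve, relative to `p`. With `g` the inverse of the
  -- complexified curve, `K ∘ g` is holomorphic and equals the conjugate of `z - p` on the curve.
  let H : ℂ → ℂ := fun t => e * (t + F t * Complex.I)
  let K : ℂ → ℂ := fun t => conj e * (t - F t * Complex.I)
  have hH : AnalyticAt ℂ H 0 := analyticAt_const.mul (analyticAt_id.add (hF.mul analyticAt_const))
  have hK : AnalyticAt ℂ K 0 := analyticAt_const.mul (analyticAt_id.sub (hF.mul analyticAt_const))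
  have hH0 : H 0 = 0 := by simp [H, hF0]
  have hK0 : K 0 = 0 := by simp [K, hF0]
  have hHp : AnalyticAt ℂ (fun t => p + H t) 0 := analyticAt_const.add hH
  have hHd : HasDerivAt (fun t => p + H t) (e * (1 + deriv F 0 * Complex.I)) 0 :=
    ((((hasDerivAt_id (0 : ℂ)).add (hF.differentiableAt.hasDerivAt.mul_const Complex.I)).const_mul
      e).const_add p)
  have hne : e * (1 + deriv F 0 * Complex.I) ≠ 0 := by
    refine mul_ne_zero he fun h0 => ?_
    have := congrArg Complex.re h0
    simp [im_deriv_eq_zero_of_real hF hf hFf] at this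
  have hcd : ContDiffAt ℂ ω (fun t => p + H t) 0 := hHp.contDiffAt
  have hfd := hHd.hasFDerivAt_equiv hne
  have hω : (ω : WithTop ℕ∞) ≠ 0 := by simp
  let g : ℂ → ℂ := hcd.localInverse hfd hω
  have hg0 : g (p + H 0) = 0 := hcd.localInverse_apply_image hfd hω
  have hg : AnalyticAt ℂ g p := by
    have := hcd.to_localInverse hfd hω
    rw [hH0, add_zero] at this
    exact this.analyticAt
  have hgH : ∀ᶠ t in 𝓝 (0 : ℂ), g (p + H t) = t :=
    (hcd.hasStrictFDerivAt' hfd hω).eventually_left_inverse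
  have hPan : AnalyticAt ℂ (fun t => P (H t) (K t)) 0 :=
    analyticAt_seriesPrimitive_comp hδ hs hH hK hH0 hK0
  refine ⟨fun z => h₁ z + P (H (g z)) (K (g z)) * 4⁻¹, hh₁.add (AnalyticAt.mul ?_ analyticAt_const),
    ?_⟩
  · rw [hH0, add_zero] at hg0
    exact AnalyticAt.comp_of_eq (f := g) hPan hg hg0
  · have hgH' : ∀ᶠ x : ℝ in 𝓝 0, g (p + H x) = x := by
      have : Tendsto (fun x : ℝ => (x : ℂ)) (𝓝 0) (𝓝 0) := by
        have := Complex.continuous_ofReal.tendsto 0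
        rwa [Complex.ofReal_zero] at this
      exact this.eventually hgH
    filter_upwards [hFf, hgH'] with x h1 h2
    have e1 : H x = e * (x + f x * Complex.I) := by simp [H, h1]
    have e2 : K x = conj (e * (x + f x * Complex.I)) := by
      simp [K, h1, sub_eq_add_neg]
    rw [e1] at h2
    simp only [h2, h₁, add_sub_cancel_left]
    rw [e1, e2]
    ring

/-! ### The Cauchy problem on a real analytic boundary -/

/-- A smooth function on `B` that solves `Δ ψ = ρ` with zero Cauchy data on `Γ`. -/
structure IsCauchySolution (Γ : Set ℂ) (ρ : ℂ → ℝ) (B : Set ℂ) (ψ : ℂ → ℝ) : Prop where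
  contDiffOn : ContDiffOn ℝ ∞ ψ B
  laplacian_eq : ∀ z ∈ B, (Δ ψ) z = ρ z
  eq_zero : ∀ z ∈ B ∩ Γ, ψ z = 0
  wirtingerDz_eq_zero : ∀ z ∈ B ∩ Γ, wirtingerDz ψ z = 0

theorem IsCauchySolution.mono {Γ B B' : Set ℂ} {ρ ψ : ℂ → ℝ} (h : IsCauchySolution Γ ρ B ψ)
    (hB : B' ⊆ B) : IsCauchySolution Γ ρ B' ψ :=
  ⟨h.contDiffOn.mono hB, fun z hz => h.laplacian_eq z (hB hz),
    fun z hz => h.eq_zero z ⟨hB hz.1, hz.2⟩, fun z hz => h.wirtingerDz_eq_zero z ⟨hB hz.1, hz.2⟩⟩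

/-- Uniqueness in the Cauchy problem: the difference of two solutions is harmonic, and its
holomorphic derivative `∂/∂z` vanishes on a set with an accumulation point. -/
theorem IsCauchySolution.eqOn {Γ C : Set ℂ} {ρ ψ₁ ψ₂ : ℂ → ℝ} (h₁ : IsCauchySolution Γ ρ C ψ₁)
    (h₂ : IsCauchySolution Γ ρ C ψ₂) (hC : IsOpen C) (hCc : IsPreconnected C) {q : ℂ} (hq : q ∈ C)
    (hqΓ : q ∈ Γ) (hacc : ∃ᶠ z in 𝓝[≠] q, z ∈ Γ) : EqOn ψ₁ ψ₂ C := by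
  have hs₁ : ∀ z ∈ C, ContDiffAt ℝ ∞ ψ₁ z := fun z hz => h₁.contDiffOn.contDiffAt (hC.mem_nhds hz)
  have hs₂ : ∀ z ∈ C, ContDiffAt ℝ ∞ ψ₂ z := fun z hz => h₂.contDiffOn.contDiffAt (hC.mem_nhds hz)
  have hd₁ : ∀ z ∈ C, DifferentiableAt ℝ ψ₁ z := fun z hz => (hs₁ z hz).differentiableAt (by simp)
  have hd₂ : ∀ z ∈ C, DifferentiableAt ℝ ψ₂ z := fun z hz => (hs₂ z hz).differentiableAt (by simp)
  let D : ℂ → ℝ := fun z => ψ₁ z - ψ₂ z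
  have hΔ : ∀ z ∈ C, (Δ D) z = 0 := fun z hz => by
    have h : (Δ D) z = (Δ ψ₁) z - (Δ ψ₂) z :=
      ContDiffAt.laplacian_sub ((hs₁ z hz).of_le (by norm_cast)) ((hs₂ z hz).of_le (by norm_cast))
    rw [h, h₁.laplacian_eq z hz, h₂.laplacian_eq z hz, sub_self]
  have hharm : ∀ z ∈ C, InnerProductSpace.HarmonicAt D z := fun z hz =>
    ⟨((hs₁ z hz).sub (hs₂ z hz)).of_le (by norm_cast), by
      filter_upwards [hC.mem_nhds hz] with w hw using hΔ w hw⟩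
  have han : AnalyticOnNhd ℂ (wirtingerDz D) C :=
    DifferentiableOn.analyticOnNhd
      (fun z hz => (wirtingerDz_differentiable (hharm z hz)).differentiableWithinAt) hC
  have hzero : EqOn (wirtingerDz D) 0 C := by
    refine han.eqOn_zero_of_preconnected_of_frequently_eq_zero hCc hq ?_
    have hev : ∀ᶠ z in 𝓝[≠] q, z ∈ C := nhdsWithin_le_nhds (hC.mem_nhds hq)
    refine (hacc.and_eventually hev).mono fun z hz => ?_
    have : wirtingerDz D z = _ := wirtingerDz_sub (hd₁ z hz.2) (hd₂ z hz.2)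
    rw [this, h₁.wirtingerDz_eq_zero z ⟨hz.2, hz.1⟩, h₂.wirtingerDz_eq_zero z ⟨hz.2, hz.1⟩,
      sub_zero]
  intro z hz
  have hconst : D z = D q := hC.is_const_of_fderiv_eq_zero hCc
    (fun w hw => ((hd₁ w hw).sub (hd₂ w hw)).differentiableWithinAt)
    (fun w hw => wirtingerDz_eq_zero_iff.1 (hzero hw)) hz hq
  have : D q = 0 := by
    simp only [D]
    rw [h₁.eq_zero q ⟨hq, hqΓ⟩, h₂.eq_zero q ⟨hq, hqΓ⟩, sub_zero]
  rw [this] at hconst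
  exact sub_eq_zero.1 hconst

/-- A point of a curve that is locally a graph is an accumulation point of the curve. -/
theorem frequently_mem_of_eventually_graph {Γ : Set ℂ} {p e : ℂ} (he : e ≠ 0) {f : ℝ → ℝ}
    (hf : ContinuousAt f 0) (hf0 : f 0 = 0)
    (hgraph : ∀ᶠ w in 𝓝 p, (w ∈ Γ ↔ ((w - p) / e).im = f ((w - p) / e).re)) :
    ∃ᶠ z in 𝓝[≠] p, z ∈ Γ := by
  let w : ℝ → ℂ := fun x => p + e * (x + f x * Complex.I)
  have hw0 : Tendsto w (𝓝 0) (𝓝 p) := by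
    have h1 : ContinuousAt w 0 := by
      refine continuousAt_const.add (continuousAt_const.mul ?_)
      exact Complex.continuous_ofReal.continuousAt.add
        ((Complex.continuous_ofReal.continuousAt.comp hf).mul continuousAt_const)
    have h2 : w 0 = p := by simp [w, hf0]
    rwa [ContinuousAt, h2] at h1
  have hdiv : ∀ x, (w x - p) / e = x + f x * Complex.I := fun x => by
    simp only [w, add_sub_cancel_left]
    exact mul_div_cancel_left₀ _ he
  have hwne : ∀ x ∈ ({0}ᶜ : Set ℝ), w x ≠ p := fun x hx h => by
    have h1 := hdiv x
    rw [h, sub_self, zero_div] at h1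
    have h2 := congrArg Complex.re h1
    simp at h2
    exact hx h2.symm
  have hw : Tendsto w (𝓝[≠] 0) (𝓝[≠] p) :=
    tendsto_nhdsWithin_of_tendsto_nhds_of_eventually_within _ (hw0.mono_left nhdsWithin_le_nhds)
      (by filter_upwards [self_mem_nhdsWithin] with x hx using hwne x hx)
  have hmem : ∀ᶠ x in 𝓝[≠] (0 : ℝ), w x ∈ Γ := by
    filter_upwards [nhdsWithin_le_nhds (hw0.eventually hgraph)] with x hx
    rw [hx, hdiv]
    simp
  exact hw.frequently hmem.frequently

/-- Local existence in the Cauchy problem on a real analytic curve. If `h` is the holomorphic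
extension of `∂u/∂z` from the curve and `k` is a primitive of `h`, then `u - 2 Re k` is a solution,
up to an additive constant. -/
theorem exists_isCauchySolution_ball {Γ : Set ℂ} {u ρ : ℂ → ℝ} (hu : ContDiff ℝ ∞ u) {p : ℂ}
    (hΔ : ∀ᶠ z in 𝓝 p, (Δ u) z = ρ z) (hρ : AnalyticAt ℝ ρ p) {e : ℂ}
    (he : ‖e‖ = 1) {f : ℝ → ℝ} (hf : AnalyticAt ℝ f 0) (hf0 : f 0 = 0)
    (hgraph : ∀ᶠ w in 𝓝 p, (w ∈ Γ ↔ ((w - p) / e).im = f ((w - p) / e).re)) :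
    ∃ R > 0, ∃ ψ, IsCauchySolution Γ ρ (Metric.ball p R) ψ := by
  have he0 : e ≠ 0 := by
    rintro rfl
    simp at he
  obtain ⟨h, hh, hhu⟩ := exists_holomorphic_extension_wirtingerDz hu hΔ hρ he0 hf hf0
  obtain ⟨R₁, hR₁, hR₁h⟩ := Metric.eventually_nhds_iff_ball.1 hh.eventually_analyticAt
  obtain ⟨R₂, hR₂, hR₂g⟩ := Metric.eventually_nhds_iff_ball.1 (hgraph.and hΔ)
  have hhd : DifferentiableOn ℂ h (Metric.ball p R₁) := fun z hz =>
    (hR₁h z hz).differentiableAt.differentiableWithinAt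
  obtain ⟨k, hk⟩ := hhd.isExactOn_ball
  let w : ℝ → ℂ := fun x => p + e * (x + f x * Complex.I)
  have hw0 : w 0 = p := by simp [w, hf0]
  have hwd : ∀ x, AnalyticAt ℝ f x → DifferentiableAt ℝ w x := fun x hx => by
    have h1 : DifferentiableAt ℝ (fun x : ℝ => (x : ℂ)) x := Complex.ofRealCLM.differentiableAt
    have h2 : DifferentiableAt ℝ (fun x : ℝ => (f x : ℂ)) x :=
      Complex.ofRealCLM.differentiableAt.comp x hx.differentiableAt
    exact ((h1.add (h2.mul_const _)).const_mul e).const_add p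
  have hwball : ∀ᶠ x in 𝓝 (0 : ℝ), w x ∈ Metric.ball p R₁ := by
    have := (hwd 0 hf).continuousAt
    rw [ContinuousAt, hw0] at this
    exact this.eventually (Metric.ball_mem_nhds p hR₁)
  obtain ⟨η, hη, hηx⟩ := Metric.eventually_nhds_iff_ball.1
    (hhu.and (hwball.and hf.eventually_analyticAt))
  let ψ₁ : ℂ → ℝ := fun z => u z - 2 * (k z).re
  have hkan : AnalyticOnNhd ℂ k (Metric.ball p R₁) :=
    DifferentiableOn.analyticOnNhd
      (fun z hz => (hk z hz).differentiableAt.differentiableWithinAt) Metric.isOpen_ball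
  have hkre : ∀ z ∈ Metric.ball p R₁, ContDiffAt ℝ ∞ (fun z => 2 * (k z).re) z := fun z hz =>
    contDiffAt_const.mul (Complex.reCLM.contDiff.contDiffAt.comp z
      ((hkan z hz).contDiffAt.restrict_scalars ℝ))
  have hψ₁s : ∀ z ∈ Metric.ball p R₁, ContDiffAt ℝ ∞ ψ₁ z := fun z hz =>
    hu.contDiffAt.sub (hkre z hz)
  have hψ₁d : ∀ z ∈ Metric.ball p R₁, DifferentiableAt ℝ ψ₁ z := fun z hz =>
    (hψ₁s z hz).differentiableAt (by simp)
  have hψ₁w : ∀ z ∈ Metric.ball p R₁, wirtingerDz ψ₁ z = wirtingerDz u z - h z := fun z hz => by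
    have h1 : wirtingerDz ψ₁ z = _ := wirtingerDz_sub (hu.differentiable (by simp) z)
      ((hkre z hz).differentiableAt (by simp))
    rw [h1, (wirtingerDz_two_mul_re (hk z hz)).2]
  have hψ₁Δ : ∀ z ∈ Metric.ball p R₁, (Δ ψ₁) z = (Δ u) z := fun z hz => by
    have h1 : (Δ ψ₁) z = (Δ u) z - (Δ fun z => 2 * (k z).re) z :=
      ContDiffAt.laplacian_sub (hu.contDiffAt.of_le (by norm_cast))
        ((hkre z hz).of_le (by norm_cast))
    have h2 : InnerProductSpace.HarmonicAt (fun z => 2 * (k z).re) z :=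
      (hkan z hz).harmonicAt_re.const_smul (c := (2 : ℝ))
    rw [h1, h2.2.eq_of_nhds]
    simp
  have hcurve : ∀ x ∈ Metric.ball (0 : ℝ) η, fderiv ℝ ψ₁ (w x) = 0 := fun x hx => by
    rw [← wirtingerDz_eq_zero_iff, hψ₁w _ (hηx x hx).2.1, sub_eq_zero]
    exact (hηx x hx).1.symm
  have hconst : ∀ x ∈ Metric.ball (0 : ℝ) η, ψ₁ (w x) = ψ₁ p := fun x hx => by
    have hder : ∀ y ∈ Metric.ball (0 : ℝ) η, HasDerivAt (fun y => ψ₁ (w y)) 0 y := fun y hy => by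
      have h1 := (hψ₁d _ (hηx y hy).2.1).hasFDerivAt.comp_hasDerivAt y
        (hwd y (hηx y hy).2.2).hasDerivAt
      rw [hcurve y hy] at h1
      exact h1
    have := Metric.isOpen_ball.is_const_of_deriv_eq_zero (convex_ball (0 : ℝ) η).isPreconnected
      (fun y hy => (hder y hy).differentiableAt.differentiableWithinAt)
      (fun y hy => (hder y hy).deriv) hx (Metric.mem_ball_self hη)
    rwa [hw0] at this
  -- Points of the curve near `p` lie on the parametrized arc.
  have hparam : ∀ z ∈ Metric.ball p (min R₂ η) ∩ Γ, ∃ x ∈ Metric.ball (0 : ℝ) η, w x = z := by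
    rintro z ⟨hz, hzΓ⟩
    have hzR₂ : z ∈ Metric.ball p R₂ := Metric.ball_subset_ball (min_le_left _ _) hz
    have hzη : ‖z - p‖ < η := mem_ball_iff_norm.1 (Metric.ball_subset_ball (min_le_right _ _) hz)
    have him := (hR₂g z hzR₂).1.1 hzΓ
    refine ⟨((z - p) / e).re, ?_, ?_⟩
    · rw [mem_ball_zero_iff, Real.norm_eq_abs]
      refine (Complex.abs_re_le_norm _).trans_lt ?_
      rwa [norm_div, he, div_one]
    · simp only [w]
      rw [← him, Complex.re_add_im, mul_div_cancel₀ _ he0]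
      ring
  refine ⟨min R₁ (min R₂ η), by positivity, fun z => ψ₁ z - ψ₁ p, ?_, ?_, ?_, ?_⟩
  · intro z hz
    exact ((hψ₁s z (Metric.ball_subset_ball (min_le_left _ _) hz)).sub
      contDiffAt_const).contDiffWithinAt
  · intro z hz
    have hz1 := Metric.ball_subset_ball (min_le_left R₁ _) hz
    have hz2 := Metric.ball_subset_ball ((min_le_right R₁ _).trans (min_le_left _ _)) hz
    have h1 : (Δ fun z => ψ₁ z - ψ₁ p) z = (Δ ψ₁) z - (Δ fun _ : ℂ => ψ₁ p) z :=
      ContDiffAt.laplacian_sub ((hψ₁s z hz1).of_le (by norm_cast)) contDiffAt_const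
    rw [h1, hψ₁Δ z hz1, (hR₂g z hz2).2]
    simp
  · rintro z ⟨hz, hzΓ⟩
    obtain ⟨x, hx, rfl⟩ := hparam z ⟨Metric.ball_subset_ball (min_le_right _ _) hz, hzΓ⟩
    rw [hconst x hx, sub_self]
  · rintro z ⟨hz, hzΓ⟩
    obtain ⟨x, hx, rfl⟩ := hparam z ⟨Metric.ball_subset_ball (min_le_right _ _) hz, hzΓ⟩
    rw [wirtingerDz_eq_zero_iff, fderiv_sub_const, hcurve x hx]

/-- Solutions of the Cauchy problem on balls centred at the points of `Γ` agree on overlaps of the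
balls of half the radius, because one of the two centres then lies in both full balls. Hence they
glue to a solution near `Γ`. -/
theorem exists_isCauchySolution_of_local {Γ : Set ℂ} {ρ : ℂ → ℝ}
    (hloc : ∀ p ∈ Γ, ∃ R > 0, ∃ ψ, IsCauchySolution Γ ρ (Metric.ball p R) ψ)
    (hacc : ∀ p ∈ Γ, ∃ᶠ z in 𝓝[≠] p, z ∈ Γ) :
    ∃ U ψ, IsOpen U ∧ Γ ⊆ U ∧ IsCauchySolution Γ ρ U ψ := by
  choose! R hR ψ hψ using hloc
  have hone : ∀ p ∈ Γ, ∀ q ∈ Γ, R q ≤ R p → ∀ z ∈ Metric.ball p (R p / 2),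
      z ∈ Metric.ball q (R q / 2) → ψ p z = ψ q z := by
    intro p hp q hq hle z hzp hzq
    rw [Metric.mem_ball] at hzp hzq
    have hRq := hR q hq
    have hRp := hR p hp
    have hqp : q ∈ Metric.ball p (R p) := by
      rw [Metric.mem_ball]
      have := dist_triangle q z p
      rw [dist_comm q z] at this
      linarith
    refine ((hψ p hp).mono inter_subset_left).eqOn ((hψ q hq).mono inter_subset_right)
      (Metric.isOpen_ball.inter Metric.isOpen_ball)
      ((convex_ball p (R p)).inter (convex_ball q (R q))).isPreconnected
      ⟨hqp, Metric.mem_ball_self hRq⟩ hq (hacc q hq) ⟨?_, ?_⟩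
    · rw [Metric.mem_ball]; linarith
    · rw [Metric.mem_ball]; linarith
  have heq : ∀ p ∈ Γ, ∀ q ∈ Γ, ∀ z ∈ Metric.ball p (R p / 2),
      z ∈ Metric.ball q (R q / 2) → ψ p z = ψ q z := by
    intro p hp q hq z hzp hzq
    rcases le_total (R q) (R p) with h | h
    · exact hone p hp q hq h z hzp hzq
    · exact (hone q hq p hp h z hzq hzp).symm
  let U : Set ℂ := ⋃ p ∈ Γ, Metric.ball p (R p / 2)
  have hmemU : ∀ z, z ∈ U ↔ ∃ p ∈ Γ, z ∈ Metric.ball p (R p / 2) := fun z => by simp [U]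
  classical
  let Ψ : ℂ → ℝ := fun z =>
    if h : ∃ p ∈ Γ, z ∈ Metric.ball p (R p / 2) then ψ h.choose z else 0
  have hΨ : ∀ p ∈ Γ, ∀ z ∈ Metric.ball p (R p / 2), Ψ z = ψ p z := by
    intro p hp z hz
    have hex : ∃ p ∈ Γ, z ∈ Metric.ball p (R p / 2) := ⟨p, hp, hz⟩
    simp only [Ψ, dif_pos hex]
    exact heq _ hex.choose_spec.1 p hp z hex.choose_spec.2 hz
  have hΨev : ∀ p ∈ Γ, ∀ z ∈ Metric.ball p (R p / 2), Ψ =ᶠ[𝓝 z] ψ p := fun p hp z hz => by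
    filter_upwards [Metric.isOpen_ball.mem_nhds hz] with w hw using hΨ p hp w hw
  have hhalf : ∀ p ∈ Γ, Metric.ball p (R p / 2) ⊆ Metric.ball p (R p) := fun p hp =>
    Metric.ball_subset_ball (by have := hR p hp; linarith)
  refine ⟨U, Ψ, isOpen_biUnion fun p _ => Metric.isOpen_ball, fun p hp =>
    (hmemU p).2 ⟨p, hp, Metric.mem_ball_self (half_pos (hR p hp))⟩, ?_, ?_, ?_, ?_⟩
  · intro z hz
    obtain ⟨p, hp, hzp⟩ := (hmemU z).1 hz
    exact (((hψ p hp).contDiffOn.contDiffAt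
      (Metric.isOpen_ball.mem_nhds (hhalf p hp hzp))).congr_of_eventuallyEq
      (hΨev p hp z hzp)).contDiffWithinAt
  · intro z hz
    obtain ⟨p, hp, hzp⟩ := (hmemU z).1 hz
    rw [(InnerProductSpace.laplacian_congr_nhds (hΨev p hp z hzp)).eq_of_nhds]
    exact (hψ p hp).laplacian_eq z (hhalf p hp hzp)
  · rintro z ⟨hz, hzΓ⟩
    obtain ⟨p, hp, hzp⟩ := (hmemU z).1 hz
    rw [hΨ p hp z hzp]
    exact (hψ p hp).eq_zero z ⟨hhalf p hp hzp, hzΓ⟩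
  · rintro z ⟨hz, hzΓ⟩
    obtain ⟨p, hp, hzp⟩ := (hmemU z).1 hz
    rw [wirtingerDz_congr (hΨev p hp z hzp)]
    exact (hψ p hp).wirtingerDz_eq_zero z ⟨hhalf p hp hzp, hzΓ⟩

/-- For real analytic data the Cauchy problem `Δ ψ = 1 / κ` has a solution `ψ` near the boundary,
and `φ = ψ + log |z|²` has the Schwarz function `1 / z`. -/
theorem exists_schwarz_of_analytic {Ω : Set ℂ} (hΩ : IsSmoothJordanDomain Ω) (h0 : (0 : ℂ) ∈ Ω)
    {V : Set ℂ} (hV : IsOpen V) (hΩV : frontier Ω ⊆ V) {κ : ℂ → ℝ} (hκ : ContDiffOn ℝ ∞ κ V)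
    (hκpos : ∀ z ∈ V, 0 < κ z) (hκan : AnalyticOnNhd ℝ κ V) (hbd : HasRealAnalyticBoundary Ω) :
    ∃ (U : Set ℂ) (φ : ℂ → ℝ) (S₀ : ℂ → ℂ),
      IsOpen U ∧ frontier Ω ⊆ U ∧ U ⊆ V ∧
      ContDiffOn ℝ ∞ φ U ∧ (∀ z ∈ U, 0 < (Δ φ) z) ∧ (∀ z ∈ U, (Δ φ) z = 1 / κ z) ∧
      IsSchwarzFunction Ω φ S₀ ∧ HolomorphicExceptSimplePoleAtZero Ω S₀ := by
  obtain ⟨χ, hχ, hχc, hχs, hχ1⟩ := hΩ.isCompact_frontier.exists_smooth_cutoff hV hΩV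
  have hρ : ContDiff ℝ ∞ (fun z => χ z * (1 / κ z)) := hχ.mul_of_tsupport_subset hV hχs
    (contDiffOn_const.div hκ fun z hz => (hκpos z hz).ne')
  obtain ⟨u, hu, hΔu⟩ := exists_contDiff_laplacian_eq hρ hχc.mul_right
  have hf0 : ∀ {p e : ℂ} {f : ℝ → ℝ}, p ∈ frontier Ω → (∀ᶠ w in 𝓝 p,
      (w ∈ frontier Ω ↔ ((w - p) / e).im = f ((w - p) / e).re)) → f 0 = 0 := fun hp hg => by
    have := hg.self_of_nhds.1 hp
    simpa using this.symm
  have hne0 : ∀ p ∈ frontier Ω, p ≠ 0 := by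
    rintro p hp rfl
    rw [hΩ.1.frontier_eq] at hp
    exact hp.2 h0
  obtain ⟨U, ψ, hU, hΩU, hψ⟩ := exists_isCauchySolution_of_local (Γ := frontier Ω)
    (ρ := fun z => 1 / κ z) (fun p hp => by
      obtain ⟨e, he, f, hf, hg⟩ := hbd p hp
      refine exists_isCauchySolution_ball hu ?_
        (analyticAt_const.div (hκan p (hΩV hp)) (hκpos p (hΩV hp)).ne') he hf (hf0 hp hg) hg
      have h1 : ∀ᶠ z in 𝓝 p, χ z = 1 := hχ1.filter_mono (nhds_le_nhdsSet hp)
      filter_upwards [h1] with z hz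
      rw [hΔu, hz, one_mul]) (fun p hp => by
      obtain ⟨e, he, f, hf, hg⟩ := hbd p hp
      refine frequently_mem_of_eventually_graph ?_ hf.continuousAt (hf0 hp hg) hg
      rintro rfl
      simp at he)
  let φ : ℂ → ℝ := fun z => ψ z + 2 * Real.log ‖z‖
  have hs : ∀ z ∈ U, ContDiffAt ℝ ∞ ψ z := fun z hz => hψ.contDiffOn.contDiffAt (hU.mem_nhds hz)
  obtain ⟨hS, hS'⟩ := isSchwarzFunction_inv_sub (φ := φ) hΩ.1 h0 (h := fun _ => 0)
    (differentiableOn_const 0) continuousOn_const (fun p hp => by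
      have h1 : wirtingerDz φ p = _ := wirtingerDz_add
        ((hs p (hΩU hp)).differentiableAt (by simp))
        ((contDiffAt_log_norm (hne0 p hp)).differentiableAt (by simp))
      rw [h1, hψ.wirtingerDz_eq_zero p ⟨hΩU hp, hp⟩, wirtingerDz_log_norm (hne0 p hp)]
      ring)
  have hΔφ : ∀ z ∈ (U ∩ V) ∩ {0}ᶜ, (Δ φ) z = 1 / κ z := fun z hz => by
    have h1 : (Δ φ) z = (Δ ψ) z :=
      laplacian_add_log_norm ((hs z hz.1.1).of_le (by norm_cast)) hz.2
    rw [h1, hψ.laplacian_eq z hz.1.1]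
  refine ⟨(U ∩ V) ∩ {0}ᶜ, φ, _, (hU.inter hV).inter isOpen_compl_singleton,
    fun p hp => ⟨⟨hΩU hp, hΩV hp⟩, hne0 p hp⟩, fun z hz => hz.1.2, ?_, ?_, hΔφ, hS, hS'⟩
  · intro z hz
    exact ((hs z hz.1.1).add (contDiffAt_log_norm hz.2)).contDiffWithinAt
  · intro z hz
    rw [hΔφ z hz]
    exact one_div_pos.2 (hκpos z hz.1.2)

theorem mainTheorem7 (Ω₀ : Set ℂ) (hΩ₀ : IsSmoothJordanDomain Ω₀) (h0 : (0 : ℂ) ∈ Ω₀)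
    (V : Set ℂ) (hV : IsOpen V) (hΩ₀V : frontier Ω₀ ⊆ V)
    (κ : ℂ → ℝ) (hκ : ContDiffOn ℝ ∞ κ V) (hκpos : ∀ z ∈ V, 0 < κ z) :
    (∃ (U : Set ℂ) (κ' φ : ℂ → ℝ) (S₀ : ℂ → ℂ),
      IsOpen U ∧ frontier Ω₀ ⊆ U ∧ U ⊆ V ∧
      ContDiffOn ℝ ∞ κ' U ∧ (∀ z ∈ U, 0 < κ' z) ∧ (∀ z ∈ U \ Ω₀, κ' z = κ z) ∧
      ContDiffOn ℝ ∞ φ U ∧ (∀ z ∈ U, 0 < (Δ φ) z) ∧ (∀ z ∈ U, (Δ φ) z = 1 / κ' z) ∧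
      IsSchwarzFunction Ω₀ φ S₀ ∧ HolomorphicExceptSimplePoleAtZero Ω₀ S₀) ∧
    (AnalyticOnNhd ℝ κ V → HasRealAnalyticBoundary Ω₀ →
      ∃ (U : Set ℂ) (φ : ℂ → ℝ) (S₀ : ℂ → ℂ),
        IsOpen U ∧ frontier Ω₀ ⊆ U ∧ U ⊆ V ∧
        ContDiffOn ℝ ∞ φ U ∧ (∀ z ∈ U, 0 < (Δ φ) z) ∧ (∀ z ∈ U, (Δ φ) z = 1 / κ z) ∧
        IsSchwarzFunction Ω₀ φ S₀ ∧ HolomorphicExceptSimplePoleAtZero Ω₀ S₀) :=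
  ⟨exists_schwarz_of_smooth hΩ₀ h0 hV hΩ₀V hκ hκpos, fun hκan hbd =>
    exists_schwarz_of_analytic hΩ₀ h0 hV hΩ₀V hκ hκpos hκan hbd⟩
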